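/- Let $N$ be a closed (compact, without boundary), connected smooth $n$-manifold, let $0<T\le\infty$, and let $F\colon N\times[0,T)\to\mathbb R^{n+1}$ be a classical solution of inverse mean curvature flow: $F$ is smooth, every $F_t=F(\cdot,t)$ is an immersion, and $$\frac{\partial F}{\partial t}(p,t)=\frac{1}{H(p,t)}\,\nu(p,t),\qquad p\in N,\ 0\le t<T,$$ where $\nu$ is a unit normal of the immersion $F_t$ and $H>0$ is its mean curvature with respect to $\nu$ (the sum of the principal curvatures, with the sign for which round spheres have $H>0$ with respect to the outward normal). Assume that $F_0$ does not parametrize its image as a multiple cover, in the sense that at least one point of $F_0(N)$ has exactly one preimage under $F_0$ (for instance, $F_0$ is an embedding). Put $N_t=F_t(N)$ and $U=\bigcup_{0\le t<T}N_t\subset\mathbb R^{n+1}$. (1) The function $u\colon U\to\mathbb R$ given by $u(x)=t$ if $x\in N_t$ is well defined and differentiable on $U$ (in the one-sided sense, relative to $U$, at points of $U$ that are not interior) with nonvanishing gradient if and only if $F_t$ is a smooth embedding for every $t\in[0,T)$. (2) In that case $u$ is a variational solution of inverse mean curvature flow on the interior $\Omega$ of $U$: $u$ is locally Lipschitz on $\Omega$,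 and for every compact $K\subset\Omega$ and every locally Lipschitz $v\colon\Omega\to\mathbb R$ for which the closure of $\{v\ne u\}$ is contained in the interior of $K$, $$\int_K|\nabla u|+u|\nabla u|\ \le\ \int_K|\nabla v|+v|\nabla u| .$$ -/

import Mathlib

open Set MeasureTheory
open scoped Manifold ContDiff

noncomputable section

namespace IMCF

/-- The Euclidean space `ℝᵏ`. -/
abbrev Euc (k : ℕ) : Type := EuclideanSpace ℝ (Fin k)

/-- The half-open time interval `[0, T)`, where `T = ∞` is allowed. -/
def timeInterval (T : EReal) : Set ℝ := {t | 0 ≤ t ∧ (t : EReal) < T}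

section Geometry

variable {n : ℕ} {N : Type*} [TopologicalSpace N] [ChartedSpace (Euc n) N]

/-- The map `f` read in the preferred chart around `p`. -/
def localParam (f : N → Euc (n + 1)) (p : N) : Euc n → Euc (n + 1) :=
  f ∘ (extChartAt (𝓡 n) p).symm

/-- First fundamental form `g_ij = ⟨∂ᵢX, ∂ⱼX⟩` at `p`, in the preferred chart around `p`. -/
def firstFundamentalForm (f : N → Euc (n + 1)) (p : N) : Matrix (Fin n) (Fin n) ℝ :=
  Matrix.of fun i j =>
    inner ℝ
      (fderiv ℝ (localParam f p) (extChartAt (𝓡 n) p p) (EuclideanSpace.single i 1))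
      (fderiv ℝ (localParam f p) (extChartAt (𝓡 n) p p) (EuclideanSpace.single j 1))

/-- Second fundamental form `h_ij = -⟨∂ᵢ∂ⱼX, ν⟩` at `p` with respect to the unit normal `ν`, in the
preferred chart around `p`. With this sign a round sphere has positive definite second fundamental
form with respect to its outward normal. -/
def secondFundamentalForm (f : N → Euc (n + 1)) (ν : Euc (n + 1)) (p : N) :
    Matrix (Fin n) (Fin n) ℝ :=
  Matrix.of fun i j =>
    - inner ℝ
      (fderiv ℝ (fun y => fderiv ℝ (localParam f p) y (EuclideanSpace.single j 1))
        (extChartAt (𝓡 n) p p) (EuclideanSpace.single i 1))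
      ν

/-- Mean curvature `H = g^{ij} h_ij` (the sum of the principal curvatures) of the immersion `f` at
`p` with respect to the unit normal `ν`. -/
def meanCurvature (f : N → Euc (n + 1)) (ν : Euc (n + 1)) (p : N) : ℝ :=
  ((firstFundamentalForm f p)⁻¹ * secondFundamentalForm f ν p).trace

/-- `ν` is a unit vector normal to the immersed hypersurface `f` at `p`. -/
def IsUnitNormal (f : N → Euc (n + 1)) (ν : Euc (n + 1)) (p : N) : Prop :=
  ‖ν‖ = 1 ∧ ∀ w : Euc n,
    inner ℝ (fderiv ℝ (localParam f p) (extChartAt (𝓡 n) p p) w) ν = 0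

/-- `F` is a classical solution of inverse mean curvature flow on `[0, T)`: a family of immersions
of `N` into `ℝⁿ⁺¹`, smooth on `[0, T) × N` (up to the initial time), with
`∂F/∂t = ν / H` and `H > 0`. Reversing `ν` changes the sign of `H`, so that `H > 0` determines the
unit normal `ν`; for an embedded closed connected hypersurface this is the outward one, because `H`
with respect to the outward normal is positive at a point of maximal distance from the origin. -/
structure IsClassicalSolution (T : EReal) (F : ℝ → N → Euc (n + 1)) : Prop where
  smooth : ContMDiffOn (𝓘(ℝ, ℝ).prod (𝓡 n)) 𝓘(ℝ, Euc (n + 1)) ∞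
    (fun z : ℝ × N => F z.1 z.2) (timeInterval T ×ˢ univ)
  immersion : ∀ t ∈ timeInterval T,
    Manifold.IsImmersion (𝓡 n) 𝓘(ℝ, Euc (n + 1)) ∞ (F t)
  flow : ∀ t ∈ timeInterval T, ∀ p : N, ∃ ν : Euc (n + 1),
    IsUnitNormal (F t) ν p ∧ 0 < meanCurvature (F t) ν p ∧
      HasDerivWithinAt (fun s => F s p) ((1 / meanCurvature (F t) ν p) • ν) (timeInterval T) t

/-- The region `U = ⋃_{0 ≤ t < T} N_t` swept out by the flow surfaces `N_t = F_t(N)`. -/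
def sweptRegion (T : EReal) (F : ℝ → N → Euc (n + 1)) : Set (Euc (n + 1)) :=
  ⋃ t ∈ timeInterval T, range (F t)

/-- `u = t` on `N_t` for every `t ∈ [0, T)`. This determines `u` on `U`; the arrival-time function
is well defined exactly if such a `u` exists. Values outside `U` are irrelevant. -/
def IsArrivalTime (T : EReal) (F : ℝ → N → Euc (n + 1)) (u : Euc (n + 1) → ℝ) : Prop :=
  ∀ t ∈ timeInterval T, ∀ x ∈ range (F t), u x = t

end Geometry

/-- The functional `J_K(u, v) = ∫_K |∇v| + v |∇u|`. For functions that are locally Lipschitz on an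
open neighbourhood of the compact set `K` the gradients exist almost everywhere on `K`, and the
integrand is bounded and measurable there. -/
def energy {k : ℕ} (K : Set (Euc k)) (u v : Euc k → ℝ) : ℝ :=
  ∫ x in K, (‖gradient v x‖ + v x * ‖gradient u x‖)

/-- `u` is a variational (weak) solution of inverse mean curvature flow on the open set `Ω`: it is
locally Lipschitz on `Ω`, and `J_K(u, u) ≤ J_K(u, v)` for all compact `K ⊆ Ω` and all locally
Lipschitz `v` with `{v ≠ u}` compactly contained in `K`. -/
def IsVariationalSolution {k : ℕ} (Ω : Set (Euc k)) (u : Euc k → ℝ) : Prop :=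
  IsOpen Ω ∧ LocallyLipschitzOn Ω u ∧
    ∀ (K : Set (Euc k)) (v : Euc k → ℝ), IsCompact K → K ⊆ Ω → LocallyLipschitzOn Ω v →
      closure {x | x ∈ Ω ∧ v x ≠ u x} ⊆ interior K → energy K u u ≤ energy K u v

end IMCF

end

open IMCF

open Filter Topology NNReal

namespace IMCF

/-! View the flow as one map (t, p) ↦ F_t(p) on space-time. Its derivative is invertible everywhere,
because the velocity ν / H is transverse to the surface; so it is locally injective, and open at
positive times. At time 0 only a one-sided version holds, and this is the main difficulty.

If u is well defined and differentiable, the chain rule forces ∇u = Hν, so two sheets through one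
point have equal velocities and therefore coincide nearby (`eventually_exists_eq_of_velocity_eq`).
The double points thus form an open subset of [0, T) × N. It is closed by compactness of N and local
injectivity, and it misses a point at time 0, so it is empty.

Conversely, suppose that every F_t is an embedding. Surfaces at different times are disjoint
(`injective_flowMap`): at a first collision with a surface of positive time, openness yields an
earlier collision, and a return to N_0 is impossible because a thin collar swept out from N_0
separates space (`exists_continuous_collar_function`). The same separation makes the inverse of the
flow continuous on U (`comap_flowMap_nhds_le`), so u, its time component, is differentiable.

For the variational statement, W = ∇u / |∇u| is a calibration: div W = H = |∇u|
(`divergence_unitNormalField`). With φ = v - u, the energy density of v exceeds that of u by at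
least div(φW), which integrates to zero. -/

/-! ### One-sided inverse function theorem -/

/-- The Lipschitz error f - f' extends from s to all of E at the cost of a dimensional constant, and
a small Lipschitz perturbation of an isomorphism is a bi-Lipschitz homeomorphism. The antilipschitz
bound later controls the time coordinate of points near N_0. -/
theorem exists_homeomorph_extension_antilipschitz {E F : Type*} [NormedAddCommGroup E]
    [NormedSpace ℝ E] [NormedAddCommGroup F] [NormedSpace ℝ F] [FiniteDimensional ℝ F] {s : Set E}
    {f : E → F} {f' : E ≃L[ℝ] F} {c : ℝ≥0} (hf : ApproximatesLinearOn f (f' : E →L[ℝ] F) s c)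
    (hc : Subsingleton E ∨ lipschitzExtensionConstant F * c < ‖(f'.symm : F →L[ℝ] E)‖₊⁻¹) :
    ∃ (g : E ≃ₜ F) (K : ℝ≥0), AntilipschitzWith K g ∧ EqOn f g s := by
  obtain ⟨u, hu, uf⟩ :
    ∃ u : E → F, LipschitzWith (lipschitzExtensionConstant F * c) u ∧ EqOn (f - ⇑f') u s :=
    hf.lipschitzOnWith.extend_finite_dimension
  let g : E → F := fun x => f' x + u x
  have fg : EqOn f g s := fun x hx => by simp_rw [g, ← uf hx, Pi.sub_apply, add_sub_cancel]
  have hg : ApproximatesLinearOn g (f' : E →L[ℝ] F) univ (lipschitzExtensionConstant F * c) := by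
    apply LipschitzOnWith.approximatesLinearOn
    rw [lipschitzOnWith_univ]
    convert hu using 1
    ext x
    simp only [g, add_sub_cancel_left, ContinuousLinearEquiv.coe_coe, Pi.sub_apply]
  have : FiniteDimensional ℝ E := f'.symm.finiteDimensional
  exact ⟨hg.toHomeomorph g hc, _,
    fun x y => hg.antilipschitz hc ⟨x, mem_univ x⟩ ⟨y, mem_univ y⟩, fg⟩

/-- One-sided inverse function theorem: a `C¹` map on the relatively open subset `C ∩ O` of a convex
set with invertible derivative at `a` agrees near `a` with a global homeomorphism. -/
theorem exists_homeomorph_eventuallyEq_nhdsWithin {E F : Type*} [NormedAddCommGroup E]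
    [NormedSpace ℝ E] [NormedAddCommGroup F] [NormedSpace ℝ F] [FiniteDimensional ℝ F]
    {C O : Set E} {f : E → F} {f' : E ≃L[ℝ] F} {a : E} (hC : Convex ℝ C)
    (hCi : (interior C).Nonempty) (hO : IsOpen O) (ha : a ∈ C ∩ O) (hf : ContDiffOn ℝ 1 f (C ∩ O))
    (hf' : HasFDerivWithinAt f (f' : E →L[ℝ] F) (C ∩ O) a) :
    ∃ (g : E ≃ₜ F) (K : ℝ≥0), AntilipschitzWith K g ∧ ∀ᶠ z in 𝓝 a, z ∈ C → f z = g z := by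
  have hu : UniqueDiffOn ℝ (C ∩ O) := (uniqueDiffOn_convex hC hCi).inter hO
  obtain ⟨c, hc0, hc⟩ : ∃ c : ℝ≥0, 0 < c ∧
      (Subsingleton E ∨ lipschitzExtensionConstant F * c < ‖(f'.symm : F →L[ℝ] E)‖₊⁻¹) := by
    rcases subsingleton_or_nontrivial E with hE | hE
    · exact ⟨1, one_pos, Or.inl hE⟩
    · have hB : 0 < ‖(f'.symm : F →L[ℝ] E)‖₊⁻¹ := by
        have := f'.nnnorm_symm_pos
        positivity
      have hL := lipschitzExtensionConstant_pos F
      refine ⟨(lipschitzExtensionConstant F)⁻¹ * (‖(f'.symm : F →L[ℝ] E)‖₊⁻¹ / 2), by positivity,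
        Or.inr ?_⟩
      rw [mul_inv_cancel_left₀ hL.ne']
      exact half_lt_self hB
  have hcont := hf.continuousOn_fderivWithin hu le_rfl a ha
  have hfa : fderivWithin ℝ f (C ∩ O) a = f' := hf'.fderivWithin (hu a ha)
  have hev : ∀ᶠ z in 𝓝[C ∩ O] a, ‖fderivWithin ℝ f (C ∩ O) z - f'‖ < c := by
    have h1 := (hcont.sub (continuousWithinAt_const (b := (f' : E →L[ℝ] F)))).norm
    have : ‖fderivWithin ℝ f (C ∩ O) a - f'‖ < c := by simpa [hfa] using hc0
    exact h1.eventually_lt continuousWithinAt_const this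
  rw [eventually_nhdsWithin_iff] at hev
  obtain ⟨r, hr, hball⟩ := Metric.eventually_nhds_iff_ball.1 (hev.and (hO.mem_nhds ha.2))
  have happ : ApproximatesLinearOn f (f' : E →L[ℝ] F) (C ∩ Metric.ball a r) c := by
    have hsub : C ∩ Metric.ball a r ⊆ C ∩ O := fun z hz => ⟨hz.1, (hball z hz.2).2⟩
    intro x hx y hy
    -- The mean value inequality needs a convex domain, hence the ball intersected with C.
    refine Convex.norm_image_sub_le_of_norm_hasFDerivWithin_le' (𝕜 := ℝ)
      (f' := fderivWithin ℝ f (C ∩ O)) (fun z hz => ?_) (fun z hz => ?_)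
      (hC.inter (convex_ball a r)) hy hx
    · exact ((hf.differentiableOn one_ne_zero z (hsub hz)).hasFDerivWithinAt).mono hsub
    · exact ((hball z hz.2).1 (hsub hz)).le
  obtain ⟨g, K, hK, hg⟩ := exists_homeomorph_extension_antilipschitz happ hc
  refine ⟨g, K, hK, ?_⟩
  filter_upwards [Metric.ball_mem_nhds a hr] with z hz hzC using hg ⟨hzC, hz⟩

/-! ### The time interval [0, T) -/

section TimeInterval

variable {T : EReal}

theorem zero_mem_timeInterval (hT : 0 < T) : (0 : ℝ) ∈ timeInterval T := ⟨le_rfl, by simpa using hT⟩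

theorem ordConnected_timeInterval : (timeInterval T).OrdConnected :=
  ⟨fun _ hx _ hy _ hz => ⟨hx.1.trans hz.1, lt_of_le_of_lt (by exact_mod_cast hz.2) hy.2⟩⟩

theorem eventually_lt_of_mem_timeInterval {t : ℝ} (ht : t ∈ timeInterval T) :
    ∀ᶠ s : ℝ in 𝓝 t, (s : EReal) < T :=
  continuous_coe_real_ereal.continuousAt.eventually_lt continuousAt_const ht.2

theorem timeInterval_mem_nhds {t : ℝ} (ht : t ∈ timeInterval T) (h0 : 0 < t) :
    timeInterval T ∈ 𝓝 t := by
  filter_upwards [eventually_lt_of_mem_timeInterval ht, lt_mem_nhds h0] with s h1 h2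
  exact ⟨h2.le, h1⟩

theorem exists_Icc_subset_timeInterval {t : ℝ} (ht : t ∈ timeInterval T) :
    ∃ δ > 0, Icc 0 (t + δ) ⊆ timeInterval T := by
  obtain ⟨δ, hδ, h⟩ := Metric.eventually_nhds_iff_ball.1 (eventually_lt_of_mem_timeInterval ht)
  refine ⟨δ / 2, by positivity, fun s hs => ⟨hs.1, lt_of_le_of_lt (b := ((t + δ / 2 : ℝ) : EReal))
    (by exact_mod_cast hs.2) (h _ ?_)⟩⟩
  rw [Metric.mem_ball, Real.dist_eq, add_sub_cancel_left, abs_of_pos (by positivity)]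
  linarith

theorem convex_timeInterval : Convex ℝ (timeInterval T) := ordConnected_timeInterval.convex

theorem interior_timeInterval_nonempty {t : ℝ} (ht : t ∈ timeInterval T) :
    (interior (timeInterval T)).Nonempty := by
  obtain ⟨δ, hδ, h⟩ := exists_Icc_subset_timeInterval ht
  have : Ioo (0 : ℝ) (t + δ) ⊆ interior (timeInterval T) :=
    (isOpen_Ioo.subset_interior_iff).2 (Ioo_subset_Icc_self.trans h)
  exact (nonempty_Ioo.2 (by linarith [ht.1])).mono this

theorem uniqueDiffOn_timeInterval : UniqueDiffOn ℝ (timeInterval T) := fun _ ht =>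
  uniqueDiffOn_convex convex_timeInterval (interior_timeInterval_nonempty ht) _ ht

end TimeInterval

/-! ### The space-time derivative of the flow in a chart -/

section LocalFlow

variable {n : ℕ} {N : Type*} [TopologicalSpace N] [ChartedSpace (Euc n) N]
  {T : EReal} {F : ℝ → N → Euc (n + 1)}

/-- The flow read in the preferred chart around `p`, as a function of time and position. -/
noncomputable def chartFlow (F : ℝ → N → Euc (n + 1)) (p : N) (z : ℝ × Euc n) : Euc (n + 1) :=
  F z.1 ((extChartAt (𝓡 n) p).symm z.2)

theorem contDiffOn_chartFlow [IsManifold (𝓡 n) ∞ N] (hF : IsClassicalSolution T F) (p : N) :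
    ContDiffOn ℝ ∞ (chartFlow F p) (timeInterval T ×ˢ (extChartAt (𝓡 n) p).target) := by
  rw [← contMDiffOn_iff_contDiffOn, modelWithCornersSelf_prod, ← chartedSpaceSelf_prod]
  have h1 : ContMDiffOn (𝓘(ℝ, ℝ).prod (𝓡 n)) (𝓘(ℝ, ℝ).prod (𝓡 n)) ∞
      (fun z : ℝ × Euc n => (z.1, (extChartAt (𝓡 n) p).symm z.2))
      (timeInterval T ×ˢ (extChartAt (𝓡 n) p).target) := by
    refine ContMDiffOn.prodMk contMDiffOn_fst ?_
    exact (contMDiffOn_extChartAt_symm p).comp contMDiffOn_snd fun z hz => hz.2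
  exact hF.smooth.comp h1 fun z hz => ⟨hz.1, mem_univ _⟩

/-- Data of the flow at a point: invertible space-time derivative `A`, whose time part is the
velocity `ν / H` and whose space part is the derivative of the immersion. -/
theorem exists_hasFDerivWithinAt_chartFlow [IsManifold (𝓡 n) ∞ N] (hF : IsClassicalSolution T F)
    {t : ℝ} (ht : t ∈ timeInterval T) (p : N) :
    ∃ (A : (ℝ × Euc n) ≃L[ℝ] Euc (n + 1)) (ν : Euc (n + 1)),
      HasFDerivWithinAt (chartFlow F p) (A : (ℝ × Euc n) →L[ℝ] Euc (n + 1))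
        (timeInterval T ×ˢ (extChartAt (𝓡 n) p).target) (t, extChartAt (𝓡 n) p p) ∧
      HasFDerivAt (localParam (F t) p) ((A : (ℝ × Euc n) →L[ℝ] Euc (n + 1)).comp
        (ContinuousLinearMap.inr ℝ ℝ (Euc n))) (extChartAt (𝓡 n) p p) ∧
      HasDerivWithinAt (fun s => F s p) (A (1, 0)) (timeInterval T) t ∧
      ‖ν‖ = 1 ∧ (∀ w, inner ℝ (A (0, w)) ν = 0) ∧ IsUnit (firstFundamentalForm (F t) p).det ∧
      0 < meanCurvature (F t) ν p ∧ A (1, 0) = (1 / meanCurvature (F t) ν p) • ν := by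
  set y := extChartAt (𝓡 n) p p with hy
  set S := timeInterval T ×ˢ (extChartAt (𝓡 n) p).target with hS
  have hyt : y ∈ (extChartAt (𝓡 n) p).target := mem_extChartAt_target p
  have hmem : (t, y) ∈ S := ⟨ht, hyt⟩
  obtain ⟨ν, ⟨hν1, hν⟩, hH, hV⟩ := hF.flow t ht p
  have hd : HasFDerivWithinAt (chartFlow F p) (fderivWithin ℝ (chartFlow F p) S (t, y)) S (t, y) :=
    ((contDiffOn_chartFlow hF p).differentiableOn (by simp) _ hmem).hasFDerivWithinAt
  set L := fderivWithin ℝ (chartFlow F p) S (t, y) with hL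
  have hX : HasFDerivAt (localParam (F t) p)
      (L.comp (ContinuousLinearMap.inr ℝ ℝ (Euc n))) y := by
    have h1 : HasFDerivWithinAt (fun w : Euc n => (t, w)) (ContinuousLinearMap.inr ℝ ℝ (Euc n))
        (extChartAt (𝓡 n) p).target y := (hasFDerivAt_prodMk_right t y).hasFDerivWithinAt
    exact (hd.comp y h1 fun w hw => mk_mem_prod ht hw).hasFDerivAt
      ((isOpen_extChartAt_target p).mem_nhds hyt)
  have hFp : HasDerivWithinAt (fun s => F s p) (L (1, 0)) (timeInterval T) t := by
    have h1 : HasDerivWithinAt (fun s : ℝ => (s, y)) (1, 0) (timeInterval T) t :=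
      (hasDerivWithinAt_id t _).prodMk (hasDerivWithinAt_const t _ y)
    have h2 := hd.comp_hasDerivWithinAt t h1 fun s hs => mk_mem_prod hs hyt
    refine h2.congr_of_mem (fun s _ => ?_) ht
    simp [chartFlow, hy]
  have hLV : L (1, 0) = (1 / meanCurvature (F t) ν p) • ν :=
    (uniqueDiffOn_timeInterval t ht).eq_deriv _ hFp hV
  have hLw : ∀ w, fderiv ℝ (localParam (F t) p) y w = L (0, w) := fun w => by
    rw [hX.fderiv]; rfl
  have hperp : ∀ w, inner ℝ (L (0, w)) ν = 0 := fun w => by rw [← hLw]; exact hν w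
  -- A singular Gram matrix would have inverse 0 by convention, hence mean curvature 0, against H >
  -- 0.
  have hdet : IsUnit (firstFundamentalForm (F t) p).det := by
    by_contra h
    rw [meanCurvature, Matrix.nonsing_inv_apply_not_isUnit _ h] at hH
    simp at hH
  have hinj0 : ∀ w, L (0, w) = 0 → w = 0 := by
    intro w hw
    have h0 : Matrix.mulVec (firstFundamentalForm (F t) p) w.ofLp = 0 := by
      ext i
      have hsum : w = ∑ j, w j • EuclideanSpace.single j (1 : ℝ) := by
        ext k; simp [Finset.sum_apply, Pi.single_apply]
      have h3 : inner ℝ (fderiv ℝ (localParam (F t) p) y (EuclideanSpace.single i 1))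
          (fderiv ℝ (localParam (F t) p) y w) = 0 := by rw [hLw w, hw, inner_zero_right]
      rw [hsum, map_sum, inner_sum] at h3
      simp only [map_smul, inner_smul_right] at h3
      simp only [Matrix.mulVec, dotProduct, firstFundamentalForm, Matrix.of_apply, Pi.zero_apply]
      rw [← h3]
      exact Finset.sum_congr rfl fun j _ => by rw [mul_comm]
    have h1 := congrArg (Matrix.mulVec (firstFundamentalForm (F t) p)⁻¹) h0
    rw [Matrix.mulVec_mulVec, Matrix.nonsing_inv_mul _ hdet, Matrix.one_mulVec,
      Matrix.mulVec_zero] at h1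
    ext i
    simpa using congrFun h1 i
  have hinj : Function.Injective L := by
    rw [injective_iff_map_eq_zero]
    rintro ⟨s, w⟩ h
    have hsw : ((s, w) : ℝ × Euc n) = s • (1, 0) + (0, w) := by simp
    rw [hsw, map_add, map_smul, hLV] at h
    -- Pairing with ν kills the tangential part and leaves s / H = 0.
    have h1 := congrArg (fun v => inner ℝ v ν) h
    simp only [inner_add_left, hperp, inner_smul_left, real_inner_self_eq_norm_sq, hν1,
      inner_zero_left] at h1
    have hs : s = 0 := by
      simpa [hH.ne'] using h1
    subst hs
    have : L (0, w) = 0 := by simpa using h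
    simp [hinj0 w this]
  have hfin : Module.finrank ℝ (ℝ × Euc n) = Module.finrank ℝ (Euc (n + 1)) := by
    simp [add_comm]
  let A : (ℝ × Euc n) ≃L[ℝ] Euc (n + 1) :=
    (LinearEquiv.ofInjectiveOfFinrankEq L.toLinearMap hinj hfin).toContinuousLinearEquiv
  have hA : (A : (ℝ × Euc n) →L[ℝ] Euc (n + 1)) = L := rfl
  have hA' : ∀ z, A z = L z := fun z => rfl
  refine ⟨A, ν, by rwa [hA], by rwa [hA], by rwa [hA'], hν1, fun w => by rw [hA']; exact hperp w,
    hdet, hH, by rwa [hA']⟩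

end LocalFlow

/-! ### Local structure of the flow map and coincidence of sheets -/

section FlowMap

variable {n : ℕ} {N : Type*} {T : EReal} {F : ℝ → N → Euc (n + 1)}

/-- The flow as a map on space-time `[0, T) × N`. -/
def flowMap (T : EReal) (F : ℝ → N → Euc (n + 1)) (m : timeInterval T × N) : Euc (n + 1) :=
  F m.1 m.2

theorem mem_sweptRegion {x : Euc (n + 1)} :
    x ∈ sweptRegion T F ↔ ∃ m : timeInterval T × N, flowMap T F m = x := by
  simp only [sweptRegion, mem_iUnion, mem_range, flowMap, Prod.exists, Subtype.exists]

theorem IsArrivalTime.apply_flowMap {u : Euc (n + 1) → ℝ} (hu : IsArrivalTime T F u)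
    (m : timeInterval T × N) : u (flowMap T F m) = m.1 := hu m.1 m.1.2 _ ⟨m.2, rfl⟩

variable [TopologicalSpace N] [ChartedSpace (Euc n) N]

theorem continuousOn_flow (hF : IsClassicalSolution T F) :
    ContinuousOn (fun z : ℝ × N => F z.1 z.2) (timeInterval T ×ˢ univ) :=
  hF.smooth.continuousOn

theorem continuous_flowMap (hF : IsClassicalSolution T F) : Continuous (flowMap T F) :=
  (continuousOn_flow hF).comp_continuous (f := fun m : timeInterval T × N => ((m.1 : ℝ), m.2))
    (by fun_prop) fun m => ⟨m.1.2, mem_univ _⟩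

variable [IsManifold (𝓡 n) ∞ N]

/-- The homeomorphism g continues the flow to negative times when m₀ lies at time 0. The agreement
is recorded twice, on space-time and on chart coordinates; the second form inverts the flow wherever
the time coordinate of g⁻¹ is admissible. -/
theorem exists_homeomorph_flowMap (hF : IsClassicalSolution T F) (m₀ : timeInterval T × N) :
    ∃ (g : (ℝ × Euc n) ≃ₜ Euc (n + 1)) (K : ℝ≥0), AntilipschitzWith K g ∧
      (∀ᶠ m in 𝓝 m₀, flowMap T F m = g (m.1, extChartAt (𝓡 n) m₀.2 m.2) ∧
        m.2 ∈ (extChartAt (𝓡 n) m₀.2).source) ∧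
      ∀ W ∈ 𝓝 m₀, ∀ᶠ z in 𝓝 ((m₀.1 : ℝ), extChartAt (𝓡 n) m₀.2 m₀.2),
        ∀ h : z.1 ∈ timeInterval T, (⟨z.1, h⟩, (extChartAt (𝓡 n) m₀.2).symm z.2) ∈ W ∧
          flowMap T F (⟨z.1, h⟩, (extChartAt (𝓡 n) m₀.2).symm z.2) = g z := by
  obtain ⟨⟨t, ht⟩, p⟩ := m₀
  simp only
  obtain ⟨A, ν, hA, -⟩ := exists_hasFDerivWithinAt_chartFlow hF ht p
  have hset : timeInterval T ×ˢ (extChartAt (𝓡 n) p).target =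
      (timeInterval T ×ˢ (univ : Set (Euc n))) ∩ (univ ×ˢ (extChartAt (𝓡 n) p).target) := by
    rw [prod_inter_prod, inter_univ, univ_inter]
  have hC := (contDiffOn_chartFlow hF p).of_le (m := 1) (by exact_mod_cast le_top)
  rw [hset] at hA hC
  obtain ⟨g, K, hK, hg⟩ := exists_homeomorph_eventuallyEq_nhdsWithin
    (convex_timeInterval.prod convex_univ)
    (by rw [interior_prod_eq]
        exact (interior_timeInterval_nonempty ht).prod (by simp))
    (isOpen_univ.prod (isOpen_extChartAt_target p))
    (hset ▸ mk_mem_prod ht (mem_extChartAt_target p)) hC hA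
  refine ⟨g, K, hK, ?_, fun W hW => ?_⟩
  · have hc : ContinuousAt (fun m : timeInterval T × N => ((m.1 : ℝ), extChartAt (𝓡 n) p m.2))
        (⟨t, ht⟩, p) :=
      (continuous_subtype_val.continuousAt.comp continuousAt_fst).prodMk
        ((continuousAt_extChartAt p).comp_of_eq continuousAt_snd rfl)
    have hs : ∀ᶠ m : timeInterval T × N in 𝓝 (⟨t, ht⟩, p),
        m.2 ∈ (extChartAt (𝓡 n) p).source :=
      continuousAt_snd.eventually (extChartAt_source_mem_nhds p)
    filter_upwards [hc.eventually hg, hs] with m h1 h2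
    refine ⟨?_, h2⟩
    rw [← h1 ⟨m.1.2, mem_univ _⟩, chartFlow, (extChartAt (𝓡 n) p).left_inv h2, flowMap]
  · obtain ⟨V, hV, W', hW', hVW⟩ := mem_nhds_prod_iff.1 hW
    obtain ⟨V', hV', hVV⟩ := mem_nhds_subtype _ _ _ |>.1 hV
    have h2 : ∀ᶠ z : ℝ × Euc n in 𝓝 (t, extChartAt (𝓡 n) p p), z.1 ∈ V' :=
      continuousAt_fst.eventually hV'
    have h3 : ∀ᶠ z : ℝ × Euc n in 𝓝 (t, extChartAt (𝓡 n) p p),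
        (extChartAt (𝓡 n) p).symm z.2 ∈ W' := by
      have : ContinuousAt (fun z : ℝ × Euc n => (extChartAt (𝓡 n) p).symm z.2)
          (t, extChartAt (𝓡 n) p p) :=
        (continuousAt_extChartAt_symm p).comp_of_eq continuousAt_snd rfl
      refine this.eventually ?_
      simpa using hW'
    filter_upwards [hg, h2, h3] with z hz1 hz2 hz3 h
    exact ⟨hVW ⟨hVV hz2, hz3⟩, hz1 ⟨h, mem_univ _⟩⟩

theorem exists_nhds_injOn_flowMap (hF : IsClassicalSolution T F) (m₀ : timeInterval T × N) :
    ∃ W ∈ 𝓝 m₀, InjOn (flowMap T F) W := by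
  obtain ⟨g, K, -, h, -⟩ := exists_homeomorph_flowMap hF m₀
  refine ⟨_, h, fun a ha b hb hab => ?_⟩
  rw [ha.1, hb.1] at hab
  have h1 := g.injective hab
  rw [Prod.mk.injEq] at h1
  exact Prod.ext (Subtype.ext h1.1) ((extChartAt (𝓡 n) m₀.2).injOn ha.2 hb.2 h1.2)

/-- At a positive time every nearby coordinate time is admissible, so the flow inherits openness
from g. -/
theorem nhds_le_map_flowMap (hF : IsClassicalSolution T F) (m₀ : timeInterval T × N)
    (h0 : 0 < (m₀.1 : ℝ)) : 𝓝 (flowMap T F m₀) ≤ map (flowMap T F) (𝓝 m₀) := by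
  obtain ⟨g, K, -, h, h'⟩ := exists_homeomorph_flowMap hF m₀
  intro s hs
  have h1 : ∀ᶠ z in 𝓝 ((m₀.1 : ℝ), extChartAt (𝓡 n) m₀.2 m₀.2), z.1 ∈ timeInterval T :=
    continuousAt_fst.eventually (timeInterval_mem_nhds m₀.1.2 h0)
  have h2 : Tendsto g.symm (𝓝 (flowMap T F m₀))
      (𝓝 ((m₀.1 : ℝ), extChartAt (𝓡 n) m₀.2 m₀.2)) := by
    have := g.symm.continuous.tendsto (flowMap T F m₀)
    rw [h.self_of_nhds.1, g.symm_apply_apply] at this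
    rwa [h.self_of_nhds.1]
  filter_upwards [h2.eventually (h1.and (h' _ hs))] with x hx
  obtain ⟨h3, h4⟩ := hx.2 hx.1
  rw [← h4.trans (g.apply_symm_apply x)]
  exact h3

/-- If the arrival time is well defined, two sheets that meet with the same velocity coincide. -/
theorem eventually_exists_eq_of_velocity_eq (hF : IsClassicalSolution T F) {u : Euc (n + 1) → ℝ}
    (hu : IsArrivalTime T F u) {t : ℝ} (ht : t ∈ timeInterval T) {p q : N} (hpq : F t p = F t q)
    {V : Euc (n + 1)} (hVp : HasDerivWithinAt (fun s => F s p) V (timeInterval T) t)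
    (hVq : HasDerivWithinAt (fun s => F s q) V (timeInterval T) t) {W : Set N} (hW : W ∈ 𝓝 p) :
    ∀ᶠ m : timeInterval T × N in 𝓝 (⟨t, ht⟩, q), ∃ y ∈ W, F m.1 y = F m.1 m.2 := by
  have hWM : {m : timeInterval T × N | m.2 ∈ W} ∈ 𝓝 ((⟨t, ht⟩, p) : timeInterval T × N) :=
    continuousAt_snd.eventually hW
  rcases ht.1.eq_or_lt with h0 | h0
  swap
  -- At positive times openness puts points near q on the sheet of p, and the arrival time forces
  -- equal times.
  · have h1 := nhds_le_map_flowMap hF (⟨t, ht⟩, p) h0 (image_mem_map hWM)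
    have h2 : flowMap T F (⟨t, ht⟩, p) = flowMap T F (⟨t, ht⟩, q) := hpq
    rw [h2] at h1
    filter_upwards [(continuous_flowMap hF).continuousAt.eventually h1] with m hm
    obtain ⟨m', hm', he⟩ := hm
    have h3 : (m'.1 : ℝ) = m.1 := by rw [← hu.apply_flowMap m', he, hu.apply_flowMap]
    exact ⟨m'.2, hm', by rw [← h3]; exact he.trans (by rw [flowMap, h3])⟩
  subst h0
  obtain ⟨g, K, hK, h, h'⟩ := exists_homeomorph_flowMap hF (⟨0, ht⟩, p)
  simp only at h h'
  have hx : flowMap T F (⟨0, ht⟩, q) = g (0, extChartAt (𝓡 n) p p) := by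
    rw [← h.self_of_nhds.1]; exact hpq.symm
  have hlt : ∀ᶠ z in 𝓝 ((0 : ℝ), extChartAt (𝓡 n) p p), (z.1 : EReal) < T :=
    continuousAt_fst.eventually (eventually_lt_of_mem_timeInterval ht)
  have hgt : Tendsto (fun m => g.symm (flowMap T F m)) (𝓝 (⟨0, ht⟩, q))
      (𝓝 ((0 : ℝ), extChartAt (𝓡 n) p p)) := by
    have := (g.symm.continuous.comp (continuous_flowMap hF)).tendsto (⟨0, ht⟩, q)
    rwa [Function.comp_apply, hx, g.symm_apply_apply] at this
  -- The time coordinate of g⁻¹ is a signed time for the sheet of p. Where it is nonnegative, the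
  -- point lies on that sheet and the signed time is the true time. It remains to exclude negative
  -- values.
  have key : ∀ᶠ m in 𝓝 ((⟨0, ht⟩, q) : timeInterval T × N), 0 ≤ (g.symm (flowMap T F m)).1 →
      (g.symm (flowMap T F m)).1 = m.1 ∧ ∃ y ∈ W, F m.1 y = F m.1 m.2 := by
    filter_upwards [hgt.eventually (hlt.and (h' _ hWM))] with m hm hm0
    obtain ⟨h1, h2⟩ := hm.2 ⟨hm0, hm.1⟩
    replace h2 := h2.trans (g.apply_symm_apply _)
    have h3 : (g.symm (flowMap T F m)).1 = m.1 := by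
      have := hu.apply_flowMap (⟨_, hm0, hm.1⟩, (extChartAt (𝓡 n) p).symm (g.symm (flowMap T F m)).2)
      rw [h2, hu.apply_flowMap] at this
      exact this.symm
    refine ⟨h3, _, h1, ?_⟩
    rw [flowMap] at h2
    simp only [h3] at h2
    exact h2
  -- Equal velocities give F r q - F r p = o(r), while F r p has signed time r; the antilipschitz
  -- bound then keeps the signed time of F r q within less than r of r.
  have hpos : ∀ᶠ r in 𝓝[>] (0 : ℝ), 0 < (g.symm (F r q)).1 := by
    have hd := hVq.sub hVp
    rw [sub_self, hasDerivWithinAt_iff_isLittleO] at hd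
    have hlo := hd.def (c := 1 / (2 * ((K : ℝ) + 1))) (by positivity)
    have hI : ∀ᶠ r : ℝ in 𝓝[>] (0 : ℝ), r ∈ timeInterval T := by
      filter_upwards [nhdsWithin_le_nhds (eventually_lt_of_mem_timeInterval ht),
        self_mem_nhdsWithin] with r h1 (h2 : 0 < r)
      exact ⟨h2.le, h1⟩
    have hle : 𝓝[>] (0 : ℝ) ≤ 𝓝[timeInterval T] 0 :=
      le_inf nhdsWithin_le_nhds (le_principal_iff.2 hI)
    have hc : ContinuousAt (fun r : ℝ => (r, extChartAt (𝓡 n) p p)) 0 := by fun_prop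
    have hp := hc.eventually (h' univ univ_mem)
    filter_upwards [hle hlo, hI, nhdsWithin_le_nhds hp, self_mem_nhdsWithin] with r h1 h2 h3
      (h4 : 0 < r)
    have h5 := (h3 h2).2
    simp only [flowMap, extChartAt_to_inv] at h5
    have h6 := hK.le_mul_dist (g.symm (F r q)) (r, extChartAt (𝓡 n) p p)
    rw [g.apply_symm_apply, ← h5, dist_eq_norm (F r q)] at h6
    simp only [Pi.sub_apply, hpq, sub_self, sub_zero, smul_zero, Real.norm_eq_abs,
      abs_of_pos h4] at h1
    have h7 : |(g.symm (F r q)).1 - r| ≤ dist (g.symm (F r q)) (r, extChartAt (𝓡 n) p p) := by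
      rw [Prod.dist_eq]
      exact le_max_left _ _
    have h8 : (K : ℝ) * ‖F r q - F r p‖ ≤ K * (1 / (2 * ((K : ℝ) + 1)) * r) := by gcongr
    have h9 : (K : ℝ) * (1 / (2 * ((K : ℝ) + 1)) * r) < r := by
      have : (K : ℝ) * (1 / (2 * ((K : ℝ) + 1)) * r) = (K / (K + 1)) * (r / 2) := by field_simp
      rw [this]
      have hk : (K : ℝ) / (K + 1) ≤ 1 := by
        rw [div_le_one (by positivity)]; linarith
      nlinarith
    have := (abs_le.1 (h7.trans (h6.trans h8))).1
    linarith
  obtain ⟨V', hV', B, hB, hVB⟩ := mem_nhds_prod_iff.1 key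
  obtain ⟨V'', hV'', hVV⟩ := mem_nhds_subtype _ _ _ |>.1 hV'
  obtain ⟨δ, hδ, hδV⟩ := Metric.mem_nhds_iff.1
    (inter_mem hV'' (eventually_lt_of_mem_timeInterval ht))
  have : LocallyConnectedSpace N := ChartedSpace.locallyConnectedSpace (Euc n) N
  obtain ⟨B', ⟨hB'o, hqB', hB'c⟩, hBB⟩ :=
    (locallyConnectedSpace_iff_hasBasis_isOpen_isConnected.1 this q).mem_iff.1 hB
  have hmemI : ∀ r ∈ Ico 0 δ, r ∈ V'' ∧ r ∈ timeInterval T := fun r hr => by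
    have : r ∈ Metric.ball (0 : ℝ) δ := by
      rw [Metric.mem_ball, Real.dist_eq, sub_zero, abs_of_nonneg hr.1]; exact hr.2
    exact ⟨(hδV this).1, hr.1, (hδV this).2⟩
  have hgood : ∀ r (hr : r ∈ Ico 0 δ), ∀ y ∈ B', 0 ≤ (g.symm (F r y)).1 →
      (g.symm (F r y)).1 = r := fun r hr y hy hn =>
    (hVB (a := (⟨r, (hmemI r hr).2⟩, y)) (mk_mem_prod (hVV (hmemI r hr).1) (hBB hy)) hn).1
  have hcont : ContinuousOn (fun z : ℝ × N => (g.symm (F z.1 z.2)).1) (Ico 0 δ ×ˢ B') :=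
    continuous_fst.comp_continuousOn (g.symm.continuous.comp_continuousOn
      ((continuousOn_flow hF).mono fun z hz => ⟨(hmemI _ hz.1).2, mem_univ _⟩))
  -- The signed time cannot vanish at r > 0, since where nonnegative it equals r. Positivity on the
  -- trajectory of q therefore spreads over the connected set (0, δ) × B'.
  have hposall : ∀ r ∈ Ioo 0 δ, ∀ y ∈ B', 0 < (g.symm (F r y)).1 := by
    intro r hr y hy
    by_contra! hneg
    obtain ⟨r', hr', hr'pos⟩ := (Filter.Eventually.and (Ioo_mem_nhdsGT hδ) hpos).exists
    have hpre : IsPreconnected (Ioo 0 δ ×ˢ B') := isPreconnected_Ioo.prod hB'c.isPreconnected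
    obtain ⟨⟨a, b⟩, ⟨ha, hb⟩, hab⟩ := hpre.intermediate_value (mk_mem_prod hr hy)
      (mk_mem_prod hr' hqB')
      (hcont.mono (prod_mono Ioo_subset_Ico_self subset_rfl)) ⟨hneg, hr'pos.le⟩
    have := hgood a ⟨ha.1.le, ha.2⟩ b hb hab.ge
    have hab' : (g.symm (F a b)).1 = 0 := hab
    linarith [ha.1]
  have hnonneg : ∀ r ∈ Ico 0 δ, ∀ y ∈ B', 0 ≤ (g.symm (F r y)).1 := by
    intro r hr y hy
    rcases hr.1.eq_or_lt with h0 | h0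
    swap
    · exact (hposall r ⟨h0, hr.2⟩ y hy).le
    subst h0
    have hc : ContinuousWithinAt (fun s : ℝ => (g.symm (F s y)).1) (Ioo 0 δ) 0 :=
      ((hcont (0, y) ⟨hr, hy⟩).comp (f := fun s : ℝ => (s, y)) (t := Ico 0 δ ×ˢ B')
        (by fun_prop) fun s hs => mk_mem_prod hs hy).mono Ioo_subset_Ico_self
    have hne : (𝓝[Ioo 0 δ] (0 : ℝ)).NeBot := by
      rw [nhdsWithin_Ioo_eq_nhdsGT hδ]; infer_instance
    refine ge_of_tendsto hc.tendsto ?_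
    filter_upwards [self_mem_nhdsWithin] with s hs using (hposall s hs y hy).le
  have hnear : ∀ᶠ m in 𝓝 ((⟨0, ht⟩, q) : timeInterval T × N), (m.1 : ℝ) < δ ∧ m.2 ∈ B' := by
    refine Filter.Eventually.and ?_ (continuousAt_snd.eventually (hB'o.mem_nhds hqB'))
    exact (continuous_subtype_val.comp continuous_fst).continuousAt.eventually_lt
      continuousAt_const hδ
  filter_upwards [key, hnear] with m h1 h2
  exact (h1 (hnonneg m.1 ⟨m.1.2.1, h2.1⟩ m.2 h2.2)).2

end FlowMap

/-! ### A differentiable arrival time forces embeddedness -/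

/-- Local injectivity prevents pairs of distinct points with equal image from accumulating on the
diagonal. -/
theorem isClosed_setOf_eq_and_ne {X Y : Type*} [TopologicalSpace X] [TopologicalSpace Y]
    [T2Space Y] {f : X → Y} (hf : Continuous f) (hinj : ∀ x, ∃ W ∈ 𝓝 x, InjOn f W) :
    IsClosed {z : X × X | f z.1 = f z.2 ∧ z.1 ≠ z.2} := by
  rw [← isOpen_compl_iff, isOpen_iff_mem_nhds]
  rintro ⟨a, b⟩ hab
  by_cases h : f a = f b
  · have : a = b := by
      by_contra hne
      exact hab ⟨h, hne⟩
    subst this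
    obtain ⟨W, hW, hi⟩ := hinj a
    filter_upwards [prod_mem_nhds hW hW] with z hz hz'
    exact hz'.2 (hi hz.1 hz.2 hz'.1)
  · filter_upwards [(isOpen_ne_fun (hf.comp continuous_fst) (hf.comp continuous_snd)).mem_nhds h]
      with z hz hz'
    exact hz hz'.1

theorem toDual_symm_eq_of_comp_eq_fst {n : ℕ} {A : (ℝ × Euc n) ≃L[ℝ] Euc (n + 1)}
    {ν : Euc (n + 1)} {H : ℝ} {L : Euc (n + 1) →L[ℝ] ℝ} (hν : ‖ν‖ = 1)
    (hperp : ∀ w, inner ℝ (A (0, w)) ν = 0) (hH : 0 < H) (hA : A (1, 0) = (1 / H) • ν)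
    (hL : ∀ z, L (A z) = z.1) :
    (InnerProductSpace.toDual ℝ (Euc (n + 1))).symm L = H • ν := by
  refine ext_inner_right ℝ fun v => ?_
  rw [InnerProductSpace.toDual_symm_apply]
  obtain ⟨⟨s, w⟩, rfl⟩ := A.surjective v
  rw [hL]
  have hsw : ((s, w) : ℝ × Euc n) = s • (1, 0) + (0, w) := by simp
  rw [hsw, map_add, map_smul, hA, inner_add_right, inner_smul_left, inner_smul_left,
    real_inner_comm (A (0, w)) ν, hperp, inner_smul_right, inner_smul_right, real_inner_self_eq_norm_sq, hν]
  simp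
  field_simp

section

variable {n : ℕ} {N : Type*} [TopologicalSpace N] [ChartedSpace (Euc n) N]
  {T : EReal} {F : ℝ → N → Euc (n + 1)}

/-- Chain rule for u(F_t(p)) = t. Derivatives within [0, T) × target are unique, so it also holds at
time 0. -/
theorem apply_eq_fst_of_hasFDerivWithinAt {u : Euc (n + 1) → ℝ} (hu : IsArrivalTime T F u)
    {t : ℝ} (ht : t ∈ timeInterval T) {p : N} {A : (ℝ × Euc n) →L[ℝ] Euc (n + 1)}
    (hA : HasFDerivWithinAt (chartFlow F p) A
        (timeInterval T ×ˢ (extChartAt (𝓡 n) p).target) (t, extChartAt (𝓡 n) p p))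
    {L : Euc (n + 1) →L[ℝ] ℝ} (hL : HasFDerivWithinAt u L (sweptRegion T F) (F t p))
    (z : ℝ × Euc n) : L (A z) = z.1 := by
  have hmem : (t, extChartAt (𝓡 n) p p) ∈ timeInterval T ×ˢ (extChartAt (𝓡 n) p).target :=
    ⟨ht, mem_extChartAt_target p⟩
  have hx : chartFlow F p (t, extChartAt (𝓡 n) p p) = F t p := by simp [chartFlow]
  rw [← hx] at hL
  have h1 := hL.comp (t, extChartAt (𝓡 n) p p) hA fun z hz =>
    mem_sweptRegion.2 ⟨(⟨z.1, hz.1⟩, _), rfl⟩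
  have h2 : HasFDerivWithinAt (fun z : ℝ × Euc n => z.1) (ContinuousLinearMap.fst ℝ ℝ (Euc n))
      (timeInterval T ×ˢ (extChartAt (𝓡 n) p).target) (t, extChartAt (𝓡 n) p p) :=
    hasFDerivWithinAt_fst
  have h3 : HasFDerivWithinAt (fun z : ℝ × Euc n => z.1) (L.comp A)
      (timeInterval T ×ˢ (extChartAt (𝓡 n) p).target) (t, extChartAt (𝓡 n) p p) :=
    h1.congr (fun z hz => (hu z.1 hz.1 _ ⟨_, rfl⟩).symm) (hu t ht _ ⟨_, rfl⟩).symm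
  have h4 := (uniqueDiffOn_timeInterval.prod
    (isOpen_extChartAt_target (I := 𝓡 n) p).uniqueDiffOn _ hmem).eq h3 h2
  exact congrArg (fun B => B z) h4

variable [IsManifold (𝓡 n) ∞ N]

theorem isClosed_setOf_flowMap_eq (hF : IsClassicalSolution T F) :
    IsClosed {z : (timeInterval T × N) × (timeInterval T × N) |
      flowMap T F z.1 = flowMap T F z.2 ∧ z.1 ≠ z.2} :=
  isClosed_setOf_eq_and_ne (continuous_flowMap hF) (exists_nhds_injOn_flowMap hF)

/-- One and the same derivative of u represents Hν for both sheets; its norm recovers H, hence also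
ν. -/
theorem exists_common_velocity (hF : IsClassicalSolution T F) {u : Euc (n + 1) → ℝ}
    (hu : IsArrivalTime T F u) (hd : DifferentiableOn ℝ u (sweptRegion T F)) {t : ℝ}
    (ht : t ∈ timeInterval T) {p q : N} (hpq : F t p = F t q) :
    ∃ V, HasDerivWithinAt (fun s => F s p) V (timeInterval T) t ∧
      HasDerivWithinAt (fun s => F s q) V (timeInterval T) t := by
  have hp : HasFDerivWithinAt u _ (sweptRegion T F) (F t p) :=
    (hd _ (mem_sweptRegion.2 ⟨(⟨t, ht⟩, p), rfl⟩)).hasFDerivWithinAt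
  have hq := hp
  rw [hpq] at hq
  obtain ⟨A, ν, hA, -, hVA, hν, hpA, -, hHA, hA1⟩ := exists_hasFDerivWithinAt_chartFlow hF ht p
  obtain ⟨B, μ, hB, -, hVB, hμ, hpB, -, hHB, hB1⟩ := exists_hasFDerivWithinAt_chartFlow hF ht q
  have h1 := toDual_symm_eq_of_comp_eq_fst hν hpA hHA hA1
    (apply_eq_fst_of_hasFDerivWithinAt hu ht hA hp)
  have h2 := toDual_symm_eq_of_comp_eq_fst hμ hpB hHB hB1
    (apply_eq_fst_of_hasFDerivWithinAt hu ht hB hq)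
  rw [h2] at h1
  have h3 := congrArg norm h1
  rw [norm_smul, norm_smul, hν, hμ, mul_one, mul_one, Real.norm_of_nonneg hHA.le,
    Real.norm_of_nonneg hHB.le] at h3
  rw [h3] at h1
  have h4 := smul_right_injective _ hHA.ne' h1
  refine ⟨A (1, 0), hVA, ?_⟩
  rwa [hA1, ← h3, ← h4, ← hB1]

theorem injective_of_differentiableOn_arrivalTime [T2Space N] [CompactSpace N] [ConnectedSpace N]
    (hT : 0 < T) (hF : IsClassicalSolution T F) (hF₀ : ∃ p : N, ∀ q : N, F 0 q = F 0 p → q = p)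
    {u : Euc (n + 1) → ℝ} (hu : IsArrivalTime T F u)
    (hd : DifferentiableOn ℝ u (sweptRegion T F)) {t : ℝ} (ht : t ∈ timeInterval T) :
    Function.Injective (F t) := by
  let D : Set (timeInterval T × N) := {m | ∃ y, F m.1 y = F m.1 m.2 ∧ y ≠ m.2}
  have hDopen : IsOpen D := by
    rw [isOpen_iff_mem_nhds]
    rintro ⟨⟨s, hs⟩, q⟩ ⟨p, hpq, hne⟩
    obtain ⟨V, hVp, hVq⟩ := exists_common_velocity hF hu hd hs hpq
    obtain ⟨W, W', hW, hW', hpW, hqW, hdisj⟩ := t2_separation hne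
    filter_upwards [eventually_exists_eq_of_velocity_eq hF hu hs hpq hVp hVq (hW.mem_nhds hpW),
      continuousAt_snd.eventually (hW'.mem_nhds hqW)] with m hm hm'
    obtain ⟨y, hy, hym⟩ := hm
    exact ⟨y, hym, fun h => disjoint_left.1 hdisj hy (h ▸ hm')⟩
  -- D is the projection, along the compact factor N, of a closed set of pairs.
  have hDclosed : IsClosed D := by
    have h1 : IsClosed {z : (timeInterval T × N) × N |
        F z.1.1 z.2 = F z.1.1 z.1.2 ∧ z.2 ≠ z.1.2} := by
      have := (isClosed_setOf_flowMap_eq hF).preimage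
        (f := fun z : (timeInterval T × N) × N => ((z.1.1, z.2), z.1)) (by fun_prop)
      convert this using 1
      ext z
      simp [flowMap, Prod.ext_iff]
    have h2 := isClosedMap_fst_of_compactSpace _ h1
    convert h2 using 1
    ext m
    simp [D]
  have : PreconnectedSpace (timeInterval T) :=
    Subtype.preconnectedSpace convex_timeInterval.isPreconnected
  have hD : D = ∅ := by
    rcases isClopen_iff.1 ⟨hDclosed, hDopen⟩ with h | h
    · exact h
    · obtain ⟨p, hp⟩ := hF₀
      have : ((⟨0, zero_mem_timeInterval hT⟩, p) : timeInterval T × N) ∈ D := h ▸ mem_univ _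
      obtain ⟨y, hy, hne⟩ := this
      exact absurd (hp y hy) hne
  intro p q hpq
  by_contra hne
  have : ((⟨t, ht⟩, q) : timeInterval T × N) ∈ D := ⟨p, hpq, hne⟩
  rw [hD] at this
  exact this

end

/-! ### Collars separate space; disjointness of the flow surfaces -/

theorem eq_of_isPreconnected_of_forall_int {X : Type*} [TopologicalSpace X] {s : Set X}
    (hs : IsPreconnected s) {f : X → ℝ} (hf : ContinuousOn f s)
    (hint_eq : ∀ x ∈ s, ∃ k : ℤ, f x = k) {a b : X} (ha : a ∈ s) (hb : b ∈ s) : f a = f b := by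
  have key : ∀ a ∈ s, ∀ b ∈ s, f a ≤ f b := by
    intro a ha b hb
    by_contra! hlt
    obtain ⟨k, hk⟩ := hint_eq b hb
    obtain ⟨l, hl⟩ := hint_eq a ha
    have hkl : k + 1 ≤ l := by
      rw [hk, hl] at hlt
      exact_mod_cast hlt
    have hkl' : (k : ℝ) + 1 ≤ l := by exact_mod_cast hkl
    obtain ⟨c, hc, hfc⟩ := hs.intermediate_value hb ha hf
      (show (k : ℝ) + 1 / 2 ∈ Icc (f b) (f a) by rw [hk, hl]; constructor <;> linarith)
    obtain ⟨j, hj⟩ := hint_eq c hc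
    rw [hj] at hfc
    have h2 : (2 * j : ℝ) = 2 * k + 1 := by linarith
    have h3 : 2 * j = 2 * k + 1 := by exact_mod_cast h2
    omega
  exact le_antisymm (key a ha b hb) (key b hb a ha)

section

variable {n : ℕ} {N : Type*} {T : EReal} {F : ℝ → N → Euc (n + 1)}

theorem isCompact_setOf_coe_le {ε : ℝ} (hε : ε ∈ timeInterval T) :
    IsCompact {s : timeInterval T | (s : ℝ) ≤ ε} := by
  rw [Subtype.isCompact_iff]
  convert isCompact_Icc (a := (0 : ℝ)) (b := ε) using 1
  ext s
  constructor
  · rintro ⟨r, hr, rfl⟩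
    exact ⟨r.2.1, hr⟩
  · intro hs
    exact ⟨⟨s, ordConnected_timeInterval.out ⟨le_rfl, lt_of_le_of_lt
      (by exact_mod_cast hε.1) hε.2⟩ hε hs⟩, hs.2, rfl⟩

theorem isCompact_setOf_time_le [TopologicalSpace N] [CompactSpace N] {ε : ℝ}
    (hε : ε ∈ timeInterval T) : IsCompact {m : timeInterval T × N | (m.1 : ℝ) ≤ ε} := by
  convert (isCompact_setOf_coe_le hε).prod (isCompact_univ (X := N)) using 1
  ext m
  simp

theorem isPreconnected_setOf_time_le [TopologicalSpace N] [ConnectedSpace N] (ε : ℝ) :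
    IsPreconnected {m : timeInterval T × N | (m.1 : ℝ) ≤ ε} := by
  have h1 : IsPreconnected {s : timeInterval T | (s : ℝ) ≤ ε} := by
    rw [← Topology.IsInducing.subtypeVal.isPreconnected_image]
    refine Set.OrdConnected.isPreconnected ⟨?_⟩
    rintro _ ⟨a, ha, rfl⟩ _ ⟨b, hb, rfl⟩ c hc
    exact ⟨⟨c, ordConnected_timeInterval.out a.2 b.2 hc⟩, hc.2.trans hb, rfl⟩
  convert h1.prod (isPreconnected_univ (α := N)) using 1
  ext m
  simp

theorem exists_isArrivalTime (hinj : Function.Injective (flowMap T F)) :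
    ∃ u : Euc (n + 1) → ℝ, IsArrivalTime T F u := by
  classical
  refine ⟨fun x => if h : ∃ m, flowMap T F m = x then (h.choose.1 : ℝ) else 0, ?_⟩
  rintro t ht _ ⟨p, rfl⟩
  have h : ∃ m, flowMap T F m = F t p := ⟨(⟨t, ht⟩, p), rfl⟩
  have h2 : h.choose = (⟨t, ht⟩, p) := hinj h.choose_spec
  simp only [dif_pos h, h2]

variable [TopologicalSpace N] [ChartedSpace (Euc n) N]

/-- A trajectory leaves the collar with Θ = 1 and, while outside, Θ is integer-valued, hence
constant. The endpoint b is reached by continuity, so F b q may itself lie on the collar. -/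
theorem collar_function_eq_one (hF : IsClassicalSolution T F) {ε : ℝ} (hε : ε ∈ timeInterval T)
    (hε0 : 0 < ε) {Θ : Euc (n + 1) → ℝ} (hΘ : Continuous Θ)
    (hΘ1 : ∀ m : timeInterval T × N, (m.1 : ℝ) ≤ ε → Θ (flowMap T F m) = m.1 / ε)
    (hΘ2 : ∀ x ∉ flowMap T F '' {m | (m.1 : ℝ) ≤ ε}, ∃ k : ℤ, Θ x = k) {b : ℝ}
    (hb : b ∈ timeInterval T) (hεb : ε < b) {q : N}
    (hq : ∀ t ∈ Ioo ε b, F t q ∉ flowMap T F '' {m | (m.1 : ℝ) ≤ ε}) : Θ (F b q) = 1 := by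
  have hsub : Icc ε b ⊆ timeInterval T := ordConnected_timeInterval.out hε hb
  have hc : ContinuousOn (fun t => Θ (F t q)) (Icc ε b) := by
    refine hΘ.comp_continuousOn ?_
    exact (continuousOn_flow hF).comp (f := fun t : ℝ => (t, q)) (by fun_prop)
      fun t ht => ⟨hsub ht, mem_univ _⟩
  have hε1 : Θ (F ε q) = 1 := by
    have := hΘ1 (⟨ε, hε⟩, q) le_rfl
    rwa [div_self hε0.ne'] at this
  have hconst : ∀ t ∈ Ico ε b, Θ (F t q) = 1 := by
    intro t ht
    rw [← hε1]
    refine eq_of_isPreconnected_of_forall_int isPreconnected_Ico (f := fun t => Θ (F t q))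
      (hc.mono Ico_subset_Icc_self) (fun s hs => ?_) ht (left_mem_Ico.2 hεb)
    rcases hs.1.eq_or_lt with h | h
    · exact ⟨1, by simp [← h, hε1]⟩
    · exact hΘ2 _ (hq s ⟨h, hs.2⟩)
  have hlim : Tendsto (fun t => Θ (F t q)) (𝓝[Ico ε b] b) (𝓝 (Θ (F b q))) :=
    (hc b (right_mem_Icc.2 hεb.le)).mono Ico_subset_Icc_self
  have hne : (𝓝[Ico ε b] b).NeBot := by
    rw [nhdsWithin_Ico_eq_nhdsLT hεb]; infer_instance
  refine tendsto_nhds_unique hlim (tendsto_const_nhds.congr' ?_)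
  filter_upwards [self_mem_nhdsWithin] with t ht using (hconst t ht).symm

variable [IsManifold (𝓡 n) ∞ N]

/-- A collar `[0, ε] × N` swept out injectively separates space: a circle-valued function winding
once across the collar lifts to a real function which equals `s / ε` on the collar and is
integer-valued off it. -/
theorem exists_continuous_collar_function [CompactSpace N] [ConnectedSpace N]
    (hF : IsClassicalSolution T F) {ε : ℝ} (hε : ε ∈ timeInterval T) (hε0 : 0 < ε)
    (hinj : InjOn (flowMap T F) {m | (m.1 : ℝ) ≤ ε}) :
    ∃ Θ : Euc (n + 1) → ℝ, Continuous Θ ∧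
      (∀ m : timeInterval T × N, (m.1 : ℝ) ≤ ε → Θ (flowMap T F m) = m.1 / ε) ∧
      ∀ x ∉ flowMap T F '' {m | (m.1 : ℝ) ≤ ε}, ∃ k : ℤ, Θ x = k := by
  classical
  set B : Set (timeInterval T × N) := {m | (m.1 : ℝ) ≤ ε} with hB
  set C := flowMap T F '' B with hC
  have hBc : IsCompact B := isCompact_setOf_time_le hε
  have hCcl : IsClosed C := (hBc.image (continuous_flowMap hF)).isClosed
  let σ : Euc (n + 1) → ℝ := fun x => if h : ∃ m ∈ B, flowMap T F m = x then (h.choose.1 : ℝ) else 0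
  have hσ : ∀ m ∈ B, σ (flowMap T F m) = m.1 := by
    intro m hm
    have h : ∃ m' ∈ B, flowMap T F m' = flowMap T F m := ⟨m, hm, rfl⟩
    simp only [σ, dif_pos h]
    rw [hinj h.choose_spec.1 hm h.choose_spec.2]
  have hσ' : ∀ x ∉ C, σ x = 0 := fun x hx => dif_neg fun ⟨m, hm, h⟩ => hx ⟨m, hm, h⟩
  have hσc : ContinuousOn σ C := by
    rw [continuousOn_iff_isClosed]
    intro Z hZ
    refine ⟨flowMap T F '' (B ∩ {m | (m.1 : ℝ) ∈ Z}), ?_, ?_⟩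
    · refine ((hBc.inter_right ?_).image (continuous_flowMap hF)).isClosed
      exact hZ.preimage (continuous_subtype_val.comp continuous_fst)
    · ext x
      constructor
      · rintro ⟨hx, m, hm, rfl⟩
        refine ⟨⟨m, ⟨hm, ?_⟩, rfl⟩, ⟨m, hm, rfl⟩⟩
        rwa [mem_preimage, hσ m hm] at hx
      · rintro ⟨⟨m, ⟨hm, hmZ⟩, rfl⟩, hx⟩
        refine ⟨?_, hx⟩
        rw [mem_preimage, hσ m hm]
        exact hmZ
  have hpi : (2 * Real.pi) ≠ 0 := by positivity
  let θ : Euc (n + 1) → Circle := fun x => Circle.exp (2 * Real.pi * (σ x / ε))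
  have hθ1 : ∀ x ∉ C, θ x = 1 := fun x hx => by simp [θ, hσ' x hx]
  have hθC : ContinuousOn θ C :=
    Circle.exp.continuous.comp_continuousOn (continuousOn_const.mul (hσc.div_const _))
  have hθ : Continuous θ := by
    rw [continuous_iff_continuousAt]
    intro x
    by_cases hx : x ∈ C
    swap
    · have : θ =ᶠ[𝓝 x] fun _ => 1 := by
        filter_upwards [hCcl.isOpen_compl.mem_nhds hx] with y hy using hθ1 y hy
      exact continuousAt_const.congr this.symm
    obtain ⟨m, hm, rfl⟩ := hx
    -- On both faces of the collar the angle is a multiple of 2π and matches the value 1 outside; at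
    -- intermediate times the collar is a neighbourhood of the point.
    by_cases hm0 : (m.1 : ℝ) = 0 ∨ (m.1 : ℝ) = ε
    · have h1 : θ (flowMap T F m) = 1 := by
        rcases hm0 with h | h
        · simp [θ, hσ m hm, h]
        · simp [θ, hσ m hm, h, hε0.ne']
      have h2 : ContinuousWithinAt θ Cᶜ (flowMap T F m) :=
        (continuousWithinAt_const (b := (1 : Circle))).congr (fun y hy => hθ1 y hy) h1
      have h3 := (hθC _ ⟨m, hm, rfl⟩).union h2
      rwa [union_compl_self, continuousWithinAt_univ] at h3
    · push Not at hm0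
      have h1 : B ∈ 𝓝 m := by
        have : ∀ᶠ m' : timeInterval T × N in 𝓝 m, (m'.1 : ℝ) < ε :=
          (continuous_subtype_val.comp continuous_fst).continuousAt.eventually_lt
            continuousAt_const (lt_of_le_of_ne hm hm0.2)
        filter_upwards [this] with m' h using h.le
      exact (hθC _ ⟨m, hm, rfl⟩).continuousAt
        (nhds_le_map_flowMap hF m (lt_of_le_of_ne m.1.2.1 (Ne.symm hm0.1)) (image_mem_map h1))
  obtain ⟨p₀⟩ : Nonempty N := inferInstance
  have h0I : (0 : ℝ) ∈ timeInterval T :=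
    ⟨le_rfl, lt_of_le_of_lt (by exact_mod_cast hε.1) hε.2⟩
  have hm₀ : ((⟨0, h0I⟩, p₀) : timeInterval T × N) ∈ B := hε0.le
  -- Euclidean space is simply connected, so θ lifts to ℝ; the lift is normalized to 0 on N_0.
  obtain ⟨Θ, ⟨hΘ0, hΘ⟩, -⟩ := Circle.isCoveringMap_exp.existsUnique_continuousMap_lifts
    ⟨θ, hθ⟩ (flowMap T F (⟨0, h0I⟩, p₀)) 0 (by simp [θ, hσ _ hm₀])
  have hΘ' : ∀ x, ∃ k : ℤ, Θ x / (2 * Real.pi) - σ x / ε = k := by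
    intro x
    have h1 : Circle.exp (Θ x) = Circle.exp (2 * Real.pi * (σ x / ε)) := congrFun hΘ x
    obtain ⟨k, hk⟩ := Circle.exp_eq_exp.1 h1
    refine ⟨k, ?_⟩
    rw [hk]
    field_simp
    ring
  refine ⟨fun x => Θ x / (2 * Real.pi), Θ.continuous.div_const _, fun m hm => ?_, fun x hx => ?_⟩
  · have hc : ContinuousOn (fun m' => Θ (flowMap T F m') / (2 * Real.pi) - m'.1 / ε) B := by
      have := continuous_flowMap hF
      fun_prop
    have h1 := eq_of_isPreconnected_of_forall_int (isPreconnected_setOf_time_le ε) hc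
      (fun m' hm' => by rw [← hσ m' hm']; exact hΘ' _) hm hm₀
    rw [hΘ0] at h1
    simp only [zero_div, sub_zero] at h1
    linarith
  · obtain ⟨k, hk⟩ := hΘ' x
    rw [hσ' x hx] at hk
    exact ⟨k, by simpa using hk⟩

/-- Embedded flow surfaces at different times are disjoint. -/
theorem injective_flowMap [CompactSpace N] [ConnectedSpace N]
    (hF : IsClassicalSolution T F) (hinj : ∀ t ∈ timeInterval T, Function.Injective (F t)) :
    Function.Injective (flowMap T F) := by
  let P : Set (timeInterval T × timeInterval T) :=
    {s | ∃ p q, F s.1 p = F s.2 q ∧ ((s.1, p) : timeInterval T × N) ≠ (s.2, q)}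
  have hPcl : IsClosed P := by
    have h1 := (isClosed_setOf_flowMap_eq hF).preimage
      (f := fun z : (timeInterval T × timeInterval T) × (N × N) =>
        ((z.1.1, z.2.1), (z.1.2, z.2.2))) (by fun_prop)
    convert isClosedMap_fst_of_compactSpace _ h1 using 1
    ext s
    simp [P, flowMap]
  have hPne : ∀ s ∈ P, (s.1 : ℝ) ≠ s.2 := by
    rintro ⟨⟨s, hs⟩, ⟨s', hs'⟩⟩ ⟨p, q, hpq, hne⟩ h
    simp only at h hpq
    subst h
    exact hne (by rw [hinj s hs hpq])
  have hPsymm : ∀ s ∈ P, s.swap ∈ P := fun s ⟨p, q, h, hne⟩ => ⟨q, p, h.symm, hne.symm⟩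
  have hPempty : P = ∅ := by
    by_contra hP
    obtain ⟨⟨a, b⟩, hab, hle⟩ : ∃ s ∈ P, (s.1 : ℝ) ≤ s.2 := by
      obtain ⟨s, hs⟩ := nonempty_iff_ne_empty.2 hP
      rcases le_total (s.1 : ℝ) s.2 with h | h
      · exact ⟨s, hs, h⟩
      · exact ⟨s.swap, hPsymm s hs, h⟩
    have hQc : IsCompact (({s : timeInterval T | (s : ℝ) ≤ b} ×ˢ {s : timeInterval T | (s : ℝ) ≤ b})
        ∩ (P ∩ {s : timeInterval T × timeInterval T | (s.1 : ℝ) ≤ s.2})) :=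
      ((isCompact_setOf_coe_le b.2).prod (isCompact_setOf_coe_le b.2)).inter_right
        (hPcl.inter (isClosed_le (by fun_prop) (by fun_prop)))
    -- First collision: minimize the later of the two times. Before t₁ the flow map is injective.
    obtain ⟨⟨s₁, t₁⟩, ⟨⟨-, ht₁b⟩, hst, hst'⟩, hmin⟩ := hQc.exists_isMinOn
      ⟨(a, b), ⟨hle, le_refl (b : ℝ)⟩, hab, hle⟩
      (continuous_subtype_val.comp continuous_snd).continuousOn
    change (t₁ : ℝ) ≤ b at ht₁b
    change (s₁ : ℝ) ≤ t₁ at hst'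
    have hlt : (s₁ : ℝ) < t₁ := lt_of_le_of_ne hst' (hPne _ hst)
    have hle' : ∀ s ∈ P, (s.1 : ℝ) ≤ s.2 → (t₁ : ℝ) ≤ s.2 := by
      intro s hs hss
      rcases le_total (s.2 : ℝ) b with h | h
      · exact hmin ⟨⟨hss.trans h, h⟩, hs, hss⟩
      · exact ht₁b.trans h
    have hinj₁ : InjOn (flowMap T F) {m | (m.1 : ℝ) < t₁} := by
      intro m hm m' hm' h
      by_contra hne
      have hmem : (m.1, m'.1) ∈ P := ⟨m.2, m'.2, h, hne⟩
      rcases le_total (m.1 : ℝ) m'.1 with h' | h'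
      · exact absurd (hle' _ hmem h') (not_le.2 hm')
      · exact absurd (hle' _ (hPsymm _ hmem) h') (not_le.2 hm)
    obtain ⟨p, q, hpq, -⟩ := hst
    simp only at hpq
    -- If s₁ = 0, the collar up to t₁ / 2 gives Θ = 1 at a point of N_0, where Θ = 0. If s₁ > 0,
    -- openness at (s₁, p) makes the trajectory of q meet earlier surfaces just before t₁.
    rcases s₁.2.1.eq_or_lt with h0 | h0
    · have ht₁0 : (0 : ℝ) < t₁ := by rw [h0]; exact hlt
      have hε : (t₁ : ℝ) / 2 ∈ timeInterval T :=
        ordConnected_timeInterval.out s₁.2 t₁.2 ⟨by rw [← h0]; positivity, by linarith⟩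
      obtain ⟨Θ, hΘ, hΘ1, hΘ2⟩ := exists_continuous_collar_function hF hε (by positivity)
        (hinj₁.mono fun m (hm : (m.1 : ℝ) ≤ t₁ / 2) => show (m.1 : ℝ) < t₁ by linarith)
      have h1 := collar_function_eq_one hF hε (by positivity) hΘ hΘ1 hΘ2 t₁.2 (by linarith)
        (q := q) fun t ht => by
          rintro ⟨m, hm, h⟩
          have htI : t ∈ timeInterval T :=
            ordConnected_timeInterval.out hε t₁.2 ⟨ht.1.le, ht.2.le⟩
          have hm' : (m.1 : ℝ) ≤ t₁ / 2 := hm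
          have h2 := hinj₁ (show (m.1 : ℝ) < t₁ by linarith)
            (show (((⟨t, htI⟩, q) : timeInterval T × N).1 : ℝ) < t₁ from ht.2) h
          rw [h2] at hm'
          exact absurd hm' (not_le.2 ht.1)
      have h2 := hΘ1 (s₁, p) (show (s₁ : ℝ) ≤ t₁ / 2 by rw [← h0]; positivity)
      have h3 : flowMap T F (s₁, p) = F t₁ q := hpq
      rw [h3, h1] at h2
      simp only [← h0, zero_div] at h2
      exact one_ne_zero h2
    · have hW : {m : timeInterval T × N | (m.1 : ℝ) < (s₁ + t₁) / 2} ∈ 𝓝 (s₁, p) :=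
        (continuous_subtype_val.comp continuous_fst).continuousAt.eventually_lt
          continuousAt_const (show (s₁ : ℝ) < (s₁ + t₁) / 2 by linarith)
      have h1 := nhds_le_map_flowMap hF (s₁, p) h0 (image_mem_map hW)
      have hsub : Ioo (s₁ : ℝ) t₁ ⊆ timeInterval T :=
        Ioo_subset_Icc_self.trans (ordConnected_timeInterval.out s₁.2 t₁.2)
      have hc : ContinuousWithinAt (fun t => F t q) (Ioo (s₁ : ℝ) t₁) t₁ :=
        ((continuousOn_flow hF) (t₁, q) ⟨t₁.2, mem_univ _⟩).comp (f := fun t : ℝ => (t, q))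
          (by fun_prop) fun t ht => ⟨hsub ht, mem_univ _⟩
      have h2 : ∀ᶠ t in 𝓝[Ioo (s₁ : ℝ) t₁] t₁, F t q ∈
          flowMap T F '' {m : timeInterval T × N | (m.1 : ℝ) < (s₁ + t₁) / 2} := by
        refine hc.eventually ?_
        change _ ∈ 𝓝 (F t₁ q)
        rw [← hpq]
        exact h1
      have hne : (𝓝[Ioo (s₁ : ℝ) t₁] (t₁ : ℝ)).NeBot := by
        rw [nhdsWithin_Ioo_eq_nhdsLT hlt]; infer_instance
      obtain ⟨t, ⟨m, hm, hmt⟩, ht, htl⟩ := (h2.and (Filter.Eventually.and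
        self_mem_nhdsWithin (nhdsWithin_le_nhds (lt_mem_nhds (show ((s₁ : ℝ) + t₁) / 2 < t₁ by linarith))))).exists
      have hm' : (m.1 : ℝ) < (s₁ + t₁) / 2 := hm
      have h3 := hinj₁ (show (m.1 : ℝ) < t₁ by linarith)
        (show (((⟨t, hsub ht⟩, q) : timeInterval T × N).1 : ℝ) < t₁ from ht.2) hmt
      rw [h3] at hm'
      exact absurd hm' (not_lt.2 htl.le)
  intro m m' h
  by_contra hne
  have : (m.1, m'.1) ∈ P := ⟨m.2, m'.2, h, hne⟩
  rw [hPempty] at this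
  exact this

/-! ### Differentiability of the arrival time -/

/-- Continuity of the inverse flow on U. At time 0 the danger is that late surfaces come back near
N_0; there Θ = 0, but Θ = 1 beyond the collar. Inside the collar compactness suffices. -/
theorem comap_flowMap_nhds_le [CompactSpace N] [ConnectedSpace N]
    (hF : IsClassicalSolution T F) (hinj : Function.Injective (flowMap T F))
    (m : timeInterval T × N) : comap (flowMap T F) (𝓝 (flowMap T F m)) ≤ 𝓝 m := by
  rcases m.1.2.1.eq_or_lt with h0 | h0
  swap
  · refine (comap_mono (nhds_le_map_flowMap hF m h0)).trans ?_
    rw [comap_map hinj]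
  obtain ⟨ε, hε0, hεI⟩ := exists_Icc_subset_timeInterval m.1.2
  rw [← h0, zero_add] at hεI
  have hε : ε ∈ timeInterval T := hεI ⟨hε0.le, le_rfl⟩
  obtain ⟨Θ, hΘ, hΘ1, hΘ2⟩ := exists_continuous_collar_function hF hε hε0 hinj.injOn
  intro W hW
  have hK : IsClosed (flowMap T F '' ({m : timeInterval T × N | (m.1 : ℝ) ≤ ε} ∩ (interior W)ᶜ)) :=
    (((isCompact_setOf_time_le hε).inter_right isOpen_interior.isClosed_compl).image
      (continuous_flowMap hF)).isClosed
  have hm0 : Θ (flowMap T F m) = 0 := by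
    rw [hΘ1 m (by rw [← h0]; exact hε0.le), ← h0, zero_div]
  refine ⟨_, inter_mem ((isOpen_lt hΘ continuous_const).mem_nhds
    (show Θ (flowMap T F m) < 1 by rw [hm0]; exact one_pos)) (hK.isOpen_compl.mem_nhds ?_), ?_⟩
  · rintro ⟨m', ⟨-, hm'⟩, h⟩
    rw [hinj h] at hm'
    exact hm' (mem_interior_iff_mem_nhds.2 hW)
  · rintro m' ⟨h1, h2⟩
    have hm' : (m'.1 : ℝ) ≤ ε := by
      by_contra! hlt
      have h3 : Θ (flowMap T F m') = 1 := by
        refine collar_function_eq_one hF hε hε0 hΘ hΘ1 hΘ2 m'.1.2 hlt fun t ht => ?_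
        rintro ⟨m'', hm'', h⟩
        have h4 : m'' = (⟨t, ordConnected_timeInterval.out hε m'.1.2 ⟨ht.1.le, ht.2.le⟩⟩, m'.2) :=
          hinj h
        rw [h4] at hm''
        exact absurd ht.1 (not_lt.2 hm'')
      exact absurd h3 (ne_of_lt h1)
    by_contra hW'
    exact h2 ⟨m', ⟨hm', fun h => hW' (interior_subset h)⟩, rfl⟩

/-- A continuous left inverse of a map with invertible derivative is differentiable, here relative
to U, and u is the time component of such an inverse. -/
theorem hasFDerivWithinAt_arrivalTime [CompactSpace N] [ConnectedSpace N]
    (hF : IsClassicalSolution T F) (hinj : Function.Injective (flowMap T F))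
    {u : Euc (n + 1) → ℝ} (hu : IsArrivalTime T F u) {t : ℝ} (ht : t ∈ timeInterval T) {p : N}
    {A : (ℝ × Euc n) ≃L[ℝ] Euc (n + 1)}
    (hA : HasFDerivWithinAt (chartFlow F p) (A : (ℝ × Euc n) →L[ℝ] Euc (n + 1))
        (timeInterval T ×ˢ (extChartAt (𝓡 n) p).target) (t, extChartAt (𝓡 n) p p)) :
    HasFDerivWithinAt u ((ContinuousLinearMap.fst ℝ ℝ (Euc n)).comp
      (A.symm : Euc (n + 1) →L[ℝ] ℝ × Euc n)) (sweptRegion T F) (F t p) := by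
  have : Nonempty (timeInterval T × N) := ⟨(⟨t, ht⟩, p)⟩
  let inv := Function.invFun (flowMap T F)
  have hinv : ∀ m, inv (flowMap T F m) = m := Function.leftInverse_invFun hinj
  have hinvt : Tendsto inv (𝓝[sweptRegion T F] (F t p)) (𝓝 (⟨t, ht⟩, p)) := by
    intro W hW
    obtain ⟨O, hO, hOW⟩ := comap_flowMap_nhds_le hF hinj _ hW
    rw [mem_map]
    filter_upwards [nhdsWithin_le_nhds hO, self_mem_nhdsWithin] with x hx hxU
    obtain ⟨m, rfl⟩ := mem_sweptRegion.1 hxU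
    rw [mem_preimage, hinv]
    exact hOW hx
  let g : Euc (n + 1) → ℝ × Euc n := fun x => ((inv x).1, extChartAt (𝓡 n) p (inv x).2)
  have hga : g (F t p) = (t, extChartAt (𝓡 n) p p) := by
    have : inv (F t p) = (⟨t, ht⟩, p) := hinv (⟨t, ht⟩, p)
    simp [g, this]
  have hsrc : ∀ᶠ x in 𝓝[sweptRegion T F] (F t p), (inv x).2 ∈ (extChartAt (𝓡 n) p).source :=
    hinvt.eventually (continuousAt_snd.eventually (extChartAt_source_mem_nhds p))
  have hgt : Tendsto g (𝓝[sweptRegion T F] (F t p))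
      (𝓝[timeInterval T ×ˢ (extChartAt (𝓡 n) p).target] (g (F t p))) := by
    rw [hga]
    refine tendsto_nhdsWithin_iff.2 ⟨?_, ?_⟩
    · have hc : ContinuousAt (fun m : timeInterval T × N => ((m.1 : ℝ), extChartAt (𝓡 n) p m.2))
          (⟨t, ht⟩, p) :=
        (continuous_subtype_val.continuousAt.comp continuousAt_fst).prodMk
          ((continuousAt_extChartAt p).comp_of_eq continuousAt_snd rfl)
      exact hc.tendsto.comp hinvt
    · filter_upwards [hsrc] with x hx
      exact ⟨(inv x).1.2, (extChartAt (𝓡 n) p).map_source hx⟩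
  have hmemU : F t p ∈ sweptRegion T F := mem_sweptRegion.2 ⟨(⟨t, ht⟩, p), rfl⟩
  rw [← hga] at hA
  have hg := HasFDerivWithinAt.of_local_left_inverse hgt hA hmemU (by
    filter_upwards [hsrc, self_mem_nhdsWithin] with x hx hxU
    obtain ⟨m, rfl⟩ := mem_sweptRegion.1 hxU
    rw [hinv] at hx
    simp only [chartFlow, g, hinv, (extChartAt (𝓡 n) p).left_inv hx]
    rfl)
  have h1 := (ContinuousLinearMap.fst ℝ ℝ (Euc n)).hasFDerivAt.comp_hasFDerivWithinAt _ hg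
  refine h1.congr (fun x hxU => ?_) (by simp [hga, hu t ht _ ⟨p, rfl⟩])
  obtain ⟨m, rfl⟩ := mem_sweptRegion.1 hxU
  simp [g, hinv, hu.apply_flowMap]

theorem differentiableOn_arrivalTime [CompactSpace N] [ConnectedSpace N]
    (hF : IsClassicalSolution T F) (hinj : Function.Injective (flowMap T F))
    {u : Euc (n + 1) → ℝ} (hu : IsArrivalTime T F u) :
    DifferentiableOn ℝ u (sweptRegion T F) := by
  intro x hx
  obtain ⟨⟨⟨t, ht⟩, p⟩, rfl⟩ := mem_sweptRegion.1 hx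
  obtain ⟨A, ν, hA, -⟩ := exists_hasFDerivWithinAt_chartFlow hF ht p
  exact (hasFDerivWithinAt_arrivalTime hF hinj hu ht hA).differentiableWithinAt

/-- Any derivative of the arrival time relative to the swept region is nonzero. -/
theorem ne_zero_of_hasFDerivWithinAt_arrivalTime (hF : IsClassicalSolution T F)
    {u : Euc (n + 1) → ℝ} (hu : IsArrivalTime T F u) {x : Euc (n + 1)} (hx : x ∈ sweptRegion T F)
    {L : Euc (n + 1) →L[ℝ] ℝ} (hL : HasFDerivWithinAt u L (sweptRegion T F) x) : L ≠ 0 := by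
  obtain ⟨⟨⟨t, ht⟩, p⟩, rfl⟩ := mem_sweptRegion.1 hx
  obtain ⟨A, ν, hA, -⟩ := exists_hasFDerivWithinAt_chartFlow hF ht p
  rintro rfl
  have := apply_eq_fst_of_hasFDerivWithinAt hu ht hA hL (1, 0)
  simp at this

theorem arrivalTime_iff_isSmoothEmbedding [T2Space N] [CompactSpace N] [ConnectedSpace N]
    (hT : 0 < T) (hF : IsClassicalSolution T F)
    (hF₀ : ∃ p : N, ∀ q : N, F 0 q = F 0 p → q = p) :
    (∃ u : Euc (n + 1) → ℝ, IsArrivalTime T F u ∧ DifferentiableOn ℝ u (sweptRegion T F) ∧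
        ∀ x ∈ sweptRegion T F, gradientWithin u (sweptRegion T F) x ≠ 0) ↔
      ∀ t ∈ timeInterval T, Manifold.IsSmoothEmbedding (𝓡 n) 𝓘(ℝ, Euc (n + 1)) ∞ (F t) := by
  constructor
  · rintro ⟨u, hu, hd, -⟩ t ht
    refine ⟨hF.immersion t ht, Topology.IsClosedEmbedding.isEmbedding ?_⟩
    refine Continuous.isClosedEmbedding ?_
      (injective_of_differentiableOn_arrivalTime hT hF hF₀ hu hd ht)
    exact (continuous_flowMap hF).comp (Continuous.prodMk_right (⟨t, ht⟩ : timeInterval T))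
  · intro h
    have hinj := injective_flowMap hF fun t ht => (h t ht).isEmbedding.injective
    obtain ⟨u, hu⟩ := exists_isArrivalTime hinj
    have hd := differentiableOn_arrivalTime hF hinj hu
    refine ⟨u, hu, hd, fun x hx h0 => ?_⟩
    refine ne_zero_of_hasFDerivWithinAt_arrivalTime hF hu hx (hd x hx).hasFDerivWithinAt ?_
    simpa [gradientWithin] using h0

end

/-! ### Calibrations and minimality -/

theorem locallyLipschitzOn_mul {X : Type*} [PseudoMetricSpace X] {s : Set X} {f g : X → ℝ}
    (hf : LocallyLipschitzOn s f) (hg : LocallyLipschitzOn s g) :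
    LocallyLipschitzOn s fun x => f x * g x := by
  rw [locallyLipschitzOn_iff_restrict] at *
  have hmul : LocallyLipschitz fun z : ℝ × ℝ => z.1 * z.2 :=
    (contDiff_fst.mul contDiff_snd : ContDiff ℝ 1 fun z : ℝ × ℝ => z.1 * z.2).locallyLipschitz
  exact hmul.comp (hf.prodMk hg)

theorem locallyLipschitzOn_of_contDiffOn {E F : Type*} [NormedAddCommGroup E] [NormedSpace ℝ E]
    [NormedAddCommGroup F] [NormedSpace ℝ F] {s : Set E} {f : E → F} (hs : IsOpen s)
    (hf : ContDiffOn ℝ 1 f s) : LocallyLipschitzOn s f := fun x hx => by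
  obtain ⟨K, t, ht, h⟩ := (hf.contDiffAt (hs.mem_nhds hx)).exists_lipschitzOnWith
  exact ⟨K, t, nhdsWithin_le_nhds ht, h⟩

/-- Near the support use the Lipschitz constant on a compact thickening; a point outside the
thickening is at distance at least δ from the support, so boundedness of f is enough. -/
theorem exists_lipschitzWith_of_hasCompactSupport {E : Type*} [NormedAddCommGroup E]
    [NormedSpace ℝ E] [FiniteDimensional ℝ E] {s : Set E} {f : E → ℝ} (hs : IsOpen s)
    (hf : LocallyLipschitzOn s f) (hc : HasCompactSupport f) (hsub : tsupport f ⊆ s) :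
    ∃ C, LipschitzWith C f := by
  have hprop : ProperSpace E := FiniteDimensional.proper ℝ E
  obtain ⟨δ, hδ, hδs⟩ := hc.isCompact.exists_cthickening_subset_open hs hsub
  obtain ⟨C, hC⟩ := (hf.mono hδs).exists_lipschitzOnWith_of_compact hc.isCompact.cthickening
  obtain ⟨M, hM⟩ := (hc.isCompact).exists_bound_of_continuousOn (hf.continuousOn.mono hsub)
  have hM' : ∀ x, |f x| ≤ |M| := by
    intro x
    by_cases hx : x ∈ tsupport f
    · exact (hM x hx).trans (le_abs_self M)
    · rw [image_eq_zero_of_notMem_tsupport hx, abs_zero]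
      positivity
  have hmem : tsupport f ⊆ Metric.cthickening δ (tsupport f) := Metric.self_subset_cthickening _
  have key : ∀ x y, x ∈ tsupport f → |f x - f y| ≤ max (C : ℝ) (2 * |M| / δ) * dist x y := by
    intro x y hx
    by_cases hy : y ∈ Metric.cthickening δ (tsupport f)
    · exact (hC.dist_le_mul x (hmem hx) y hy).trans
        (mul_le_mul_of_nonneg_right (le_max_left _ _) dist_nonneg)
    · have hd : δ ≤ dist x y := by
        by_contra! hlt
        exact hy (Metric.mem_cthickening_of_dist_le y x δ _ hx (by rw [dist_comm]; exact hlt.le))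
      have h1 : |f x - f y| ≤ 2 * |M| := by
        have := abs_sub (f x) (f y)
        linarith [hM' x, hM' y]
      have h2 : 2 * |M| ≤ 2 * |M| / δ * dist x y := by
        rw [div_mul_eq_mul_div, le_div_iff₀ hδ]
        gcongr
      exact (h1.trans h2).trans (mul_le_mul_of_nonneg_right (le_max_right _ _) dist_nonneg)
  refine ⟨_, LipschitzWith.of_dist_le' (K := max (C : ℝ) (2 * |M| / δ)) fun x y => ?_⟩
  rw [Real.dist_eq]
  by_cases hx : x ∈ tsupport f
  · exact key x y hx
  by_cases hy : y ∈ tsupport f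
  · rw [abs_sub_comm, dist_comm]
    exact key y x hy
  · rw [image_eq_zero_of_notMem_tsupport hx, image_eq_zero_of_notMem_tsupport hy, sub_zero, abs_zero]
    exact mul_nonneg (le_max_of_le_left C.2) dist_nonneg

theorem integral_lineDeriv_eq_zero {E : Type*} [NormedAddCommGroup E]
    [NormedSpace ℝ E] [FiniteDimensional ℝ E] [MeasurableSpace E] [BorelSpace E] {μ : Measure E}
    [μ.IsAddHaarMeasure] {f : E → ℝ} {C : ℝ≥0} (hf : LipschitzWith C f) (hc : HasCompactSupport f)
    (v : E) : ∫ x, lineDeriv ℝ f x v ∂μ = 0 := by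
  -- Integration by parts against the constant 1; the sign of the direction flips.
  have h := LipschitzWith.integral_lineDeriv_mul_eq (μ := μ) (LipschitzWith.const (α := E) (1 : ℝ))
    hf hc (-v)
  simpa [lineDeriv] using h.symm

/-- A unit vector field `W` with `⟨∇u, W⟩ = |∇u| = div W` calibrates `u`. -/
theorem isVariationalSolution_of_calibration {k : ℕ} {Ω : Set (Euc k)} (hΩ : IsOpen Ω)
    {u : Euc k → ℝ} {W : Euc k → Euc k} (hu : ContDiffOn ℝ 1 u Ω) (hW : ContDiffOn ℝ 1 W Ω)
    (hW1 : ∀ x ∈ Ω, ‖W x‖ ≤ 1) (hgrad : ∀ x ∈ Ω, inner ℝ (gradient u x) (W x) = ‖gradient u x‖)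
    (hdiv : ∀ x ∈ Ω, ∑ i, (fderiv ℝ W x (EuclideanSpace.single i 1)) i = ‖gradient u x‖) :
    IsVariationalSolution Ω u := by
  classical
  have hulip := locallyLipschitzOn_of_contDiffOn hΩ hu
  refine ⟨hΩ, hulip, fun K v hK hKΩ hv hsupp => ?_⟩
  -- Outside Ω nothing is known about v, so the difference is cut off there.
  set φ : Euc k → ℝ := Ω.indicator fun x => v x - u x with hφ
  have hφΩ : ∀ x ∈ Ω, φ x = v x - u x := fun x hx => indicator_of_mem hx _
  have hsuppφ : tsupport φ ⊆ interior K := by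
    refine (closure_mono fun x hx => ?_).trans hsupp
    have hxΩ : x ∈ Ω := by
      by_contra h
      exact hx (indicator_of_notMem h _)
    refine ⟨hxΩ, fun h => hx ?_⟩
    rw [hφΩ x hxΩ, h, sub_self]
  have hcφ : HasCompactSupport φ :=
    hK.of_isClosed_subset (isClosed_tsupport φ) (hsuppφ.trans interior_subset)
  have hφlip : LocallyLipschitzOn Ω φ := by
    have h := hv.sub hulip
    intro x hx
    obtain ⟨C, t, ht, hC⟩ := h hx
    refine ⟨C, t ∩ Ω, inter_mem ht self_mem_nhdsWithin, fun y hy z hz => ?_⟩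
    rw [hφΩ y hy.2, hφΩ z hz.2]
    exact hC hy.1 hz.1
  obtain ⟨C, hC⟩ := exists_lipschitzWith_of_hasCompactSupport hΩ hφlip hcφ
    (hsuppφ.trans (interior_subset.trans hKΩ))
  have hWi : ∀ i, ContDiffOn ℝ 1 (fun x => W x i) Ω := fun i =>
    (EuclideanSpace.proj (𝕜 := ℝ) i).contDiff.comp_contDiffOn hW
  set ψ : Fin k → Euc k → ℝ := fun i x => φ x * W x i with hψ
  have hψsupp : ∀ i, tsupport (ψ i) ⊆ tsupport φ := fun i =>
    closure_mono fun x hx h => hx (by simp [hψ, h])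
  have hψc : ∀ i, HasCompactSupport (ψ i) := fun i =>
    hcφ.isCompact.of_isClosed_subset (isClosed_tsupport _) (hψsupp i)
  have hψlip : ∀ i, ∃ C, LipschitzWith C (ψ i) := fun i =>
    exists_lipschitzWith_of_hasCompactSupport hΩ
      (locallyLipschitzOn_mul hφlip (locallyLipschitzOn_of_contDiffOn hΩ (hWi i))) (hψc i)
      ((hψsupp i).trans (hsuppφ.trans (interior_subset.trans hKΩ)))
  choose Cψ hCψ using hψlip
  have hint_eq : ∀ i, IntegrableOn (fun x => lineDeriv ℝ (ψ i) x (EuclideanSpace.single i 1)) K :=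
    fun i => ((hCψ i).locallyIntegrable_lineDeriv _).integrableOn_isCompact hK
  -- Divergence theorem for the compactly supported Lipschitz field φW.
  have hzero : ∫ x in K, ∑ i, lineDeriv ℝ (ψ i) x (EuclideanSpace.single i 1) = 0 := by
    rw [integral_finsetSum _ fun i _ => hint_eq i]
    refine Finset.sum_eq_zero fun i _ => ?_
    rw [setIntegral_eq_integral_of_forall_compl_eq_zero, integral_lineDeriv_eq_zero (hCψ i) (hψc i)]
    intro x hx
    have hx' : x ∉ tsupport (ψ i) := fun h => hx (interior_subset (hsuppφ (hψsupp i h)))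
    have h0 : ψ i =ᶠ[𝓝 x] fun _ => (0 : ℝ) := notMem_tsupport_iff_eventuallyEq.1 hx'
    rw [h0.lineDeriv_eq]
    simp [lineDeriv]
  have hnorm : ∀ (f : Euc k → ℝ) x, ‖gradient f x‖ = ‖fderiv ℝ f x‖ := fun f x => by
    rw [gradient, LinearIsometryEquiv.norm_map]
  have hgu : ContinuousOn (fun x => ‖gradient u x‖) K := by
    simp only [hnorm]
    exact ((hu.continuousOn_fderiv_of_isOpen hΩ le_rfl).mono hKΩ).norm
  have hgv : IntegrableOn (fun x => ‖gradient v x‖) K := by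
    simp only [hnorm]
    obtain ⟨δ, hδ, hδs⟩ := hK.exists_cthickening_subset_open hΩ hKΩ
    obtain ⟨D, hD⟩ := (hv.mono hδs).exists_lipschitzOnWith_of_compact hK.cthickening
    refine Measure.integrableOn_of_bounded (M := D) hK.measure_lt_top.ne
      (measurable_fderiv ℝ v).norm.aestronglyMeasurable ?_
    filter_upwards [ae_restrict_mem hK.measurableSet] with x hx
    rw [norm_norm]
    exact norm_fderiv_le_of_lipschitzOn ℝ (mem_of_superset
      (Metric.closedBall_mem_nhds x hδ) (Metric.closedBall_subset_cthickening hx δ)) hD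
  have hJu : IntegrableOn (fun x => ‖gradient u x‖ + u x * ‖gradient u x‖) K :=
    (hgu.add ((hu.continuousOn.mono hKΩ).mul hgu)).integrableOn_compact hK
  have hJv : IntegrableOn (fun x => ‖gradient v x‖ + v x * ‖gradient u x‖) K :=
    hgv.add (((hv.continuousOn.mono hKΩ).mul hgu).integrableOn_compact hK)
  rw [energy, energy, ← sub_nonneg, ← integral_sub hJv hJu, ← hzero]
  refine setIntegral_mono_on_ae (integrable_finsetSum _ fun i _ => hint_eq i) (hJv.sub hJu)
    hK.measurableSet ?_
  filter_upwards [hC.ae_differentiableAt] with x hφx hxK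
  have hx : x ∈ Ω := hKΩ hxK
  have hux : DifferentiableAt ℝ u x := (hu.contDiffAt (hΩ.mem_nhds hx)).differentiableAt one_ne_zero
  have hWx : DifferentiableAt ℝ W x := (hW.contDiffAt (hΩ.mem_nhds hx)).differentiableAt one_ne_zero
  have hveq : v =ᶠ[𝓝 x] fun y => u y + φ y := by
    filter_upwards [hΩ.mem_nhds hx] with y hy
    rw [hφΩ y hy]; ring
  have hgradv : gradient v x = gradient u x + gradient φ x := by
    rw [gradient, gradient, gradient, ← map_add, hveq.fderiv_eq, fderiv_fun_add hux hφx]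
  have hsum : ∑ i, lineDeriv ℝ (ψ i) x (EuclideanSpace.single i 1) =
      inner ℝ (gradient φ x) (W x) + φ x * ‖gradient u x‖ := by
    rw [← hdiv x hx, Finset.mul_sum, PiLp.inner_apply, ← Finset.sum_add_distrib]
    refine Finset.sum_congr rfl fun i _ => ?_
    have hWix : HasFDerivAt (fun y => W y i)
        ((EuclideanSpace.proj (𝕜 := ℝ) i).comp (fderiv ℝ W x)) x :=
      (EuclideanSpace.proj (𝕜 := ℝ) i).hasFDerivAt.comp x hWx.hasFDerivAt
    have h1 : HasFDerivAt (ψ i) _ x := hφx.hasFDerivAt.mul hWix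
    have h2 : fderiv ℝ φ x (EuclideanSpace.single i 1) = gradient φ x i := by
      rw [← InnerProductSpace.toDual_symm_apply, EuclideanSpace.inner_single_right]
      simp [gradient]
    rw [h1.differentiableAt.lineDeriv_eq_fderiv, h1.fderiv]
    simp [h2]
    ring
  rw [hsum]
  -- Calibration inequality: its left side equals |∇u| + ⟨∇φ, W⟩.
  have h3 : inner ℝ (gradient v x) (W x) ≤ ‖gradient v x‖ := by
    refine (real_inner_le_norm _ _).trans ?_
    exact mul_le_of_le_one_right (norm_nonneg _) (hW1 x hx)
  rw [hgradv, inner_add_left, hgrad x hx, ← hgradv] at h3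
  rw [hφΩ x hx]
  have : ∀ a b c d e : ℝ, c + e ≤ d → e + (a - b) * c ≤ d + a * c - (c + b * c) := by
    intros; linarith
  exact this _ _ _ _ _ h3

/-! ### Mean curvature as the divergence of the unit normal field -/

/-- The trace of an endomorphism in terms of the Gram matrix of a tangent frame and a unit normal
which the endomorphism maps to a tangent vector. -/
theorem sum_apply_single_eq_trace {n : ℕ} {b : Fin n → Euc (n + 1)} {ν : Euc (n + 1)}
    {D : Euc (n + 1) →L[ℝ] Euc (n + 1)} {g h : Matrix (Fin n) (Fin n) ℝ}
    (hg : ∀ i j, g i j = inner ℝ (b i) (b j)) (hdet : IsUnit g.det) (hν : ‖ν‖ = 1)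
    (hb : ∀ i, inner ℝ (b i) ν = 0)
    (hspan : ∀ v, ∃ (s : ℝ) (w : Fin n → ℝ), v = s • ν + ∑ i, w i • b i)
    (hD : inner ℝ (D ν) ν = 0) (hh : ∀ i j, h i j = inner ℝ (b j) (D (b i))) :
    ∑ k, (D (EuclideanSpace.single k 1)) k = (g⁻¹ * h).trace := by
  -- Expansion in the frame, with coefficients from the dual frame Σ_j g^{ij} b_j.
  have hid : ∀ v, v = inner ℝ ν v • ν + ∑ i, (∑ j, g⁻¹ i j * inner ℝ (b j) v) • b i := by
    intro v
    obtain ⟨s, w, rfl⟩ := hspan v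
    have h1 : inner ℝ ν (s • ν + ∑ i, w i • b i) = s := by
      rw [real_inner_comm]
      simp [inner_add_left, sum_inner, inner_smul_left, hb, hν]
    have h2 : ∀ j, inner ℝ (b j) (s • ν + ∑ i, w i • b i) = (g.mulVec w) j := by
      intro j
      simp [inner_add_right, inner_sum, inner_smul_right, hb, hg, Matrix.mulVec, dotProduct,
        mul_comm]
    have h3 : ∀ i, ∑ j, g⁻¹ i j * (g.mulVec w) j = w i := by
      intro i
      have : (g⁻¹.mulVec (g.mulVec w)) i = w i := by
        rw [Matrix.mulVec_mulVec, Matrix.nonsing_inv_mul _ hdet, Matrix.one_mulVec]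
      exact this
    simp only [h1, h2, h3]
  have hsymm : ∀ i j, g⁻¹ i j = g⁻¹ j i := by
    have hgt : g.transpose = g := by
      ext i j
      rw [Matrix.transpose_apply, hg, hg, real_inner_comm]
    intro i j
    have : g⁻¹.transpose = g⁻¹ := by rw [Matrix.transpose_nonsing_inv, hgt]
    exact congrFun (congrFun this j) i
  have hpar : ∀ x y : Euc (n + 1), ∑ k, inner ℝ x (EuclideanSpace.single k 1) * y k = inner ℝ x y := by
    intro x y
    rw [PiLp.inner_apply]
    exact Finset.sum_congr rfl fun k _ => by simp [EuclideanSpace.inner_single_right, mul_comm]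
  have hexp : ∀ k, (D (EuclideanSpace.single k 1)) k =
      inner ℝ ν (EuclideanSpace.single k 1) * (D ν) k +
        ∑ i, ∑ j, g⁻¹ i j * (inner ℝ (b j) (EuclideanSpace.single k 1) * (D (b i)) k) := by
    intro k
    conv_lhs => rw [hid (EuclideanSpace.single k 1)]
    simp only [map_add, map_smul, map_sum, PiLp.add_apply, PiLp.smul_apply, smul_eq_mul,
      WithLp.ofLp_sum, Finset.sum_apply, Finset.sum_mul, mul_assoc]
  simp only [hexp, Finset.sum_add_distrib]
  rw [hpar, real_inner_comm, hD, zero_add, Finset.sum_comm, Matrix.trace]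
  simp only [Matrix.diag_apply, Matrix.mul_apply]
  conv_rhs => rw [Finset.sum_comm]
  refine Finset.sum_congr rfl fun i _ => ?_
  rw [Finset.sum_comm]
  refine Finset.sum_congr rfl fun j _ => ?_
  rw [← Finset.mul_sum, hpar, hh, hsymm]

section

variable {n : ℕ} {N : Type*} [TopologicalSpace N] [ChartedSpace (Euc n) N]
  {T : EReal} {F : ℝ → N → Euc (n + 1)} {u : Euc (n + 1) → ℝ}

theorem gradient_arrivalTime (hu : IsArrivalTime T F u) {t : ℝ}
    (ht : t ∈ timeInterval T) {p : N} (hd : DifferentiableAt ℝ u (F t p))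
    {A : (ℝ × Euc n) ≃L[ℝ] Euc (n + 1)} {ν : Euc (n + 1)} {H : ℝ}
    (hA : HasFDerivWithinAt (chartFlow F p) (A : (ℝ × Euc n) →L[ℝ] Euc (n + 1))
        (timeInterval T ×ˢ (extChartAt (𝓡 n) p).target) (t, extChartAt (𝓡 n) p p))
    (hν : ‖ν‖ = 1) (hperp : ∀ w, inner ℝ (A (0, w)) ν = 0) (hH : 0 < H)
    (hA1 : A (1, 0) = (1 / H) • ν) : gradient u (F t p) = H • ν :=
  toDual_symm_eq_of_comp_eq_fst hν hperp hH hA1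
    (apply_eq_fst_of_hasFDerivWithinAt hu ht hA hd.hasFDerivAt.hasFDerivWithinAt)

variable [IsManifold (𝓡 n) ∞ N]

/-- At an interior point of N_0, u would have a local minimum and so zero derivative. -/
theorem pos_of_mem_interior_sweptRegion [CompactSpace N] [ConnectedSpace N]
    (hF : IsClassicalSolution T F) (hinj : Function.Injective (flowMap T F))
    (hu : IsArrivalTime T F u) {t : ℝ} (ht : t ∈ timeInterval T) {p : N}
    (hx : F t p ∈ interior (sweptRegion T F)) : 0 < t := by
  refine lt_of_le_of_ne ht.1 fun h0 => ?_
  have hnhds : sweptRegion T F ∈ 𝓝 (F t p) := mem_interior_iff_mem_nhds.1 hx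
  have hmin : IsLocalMin u (F t p) := by
    filter_upwards [hnhds] with y hy
    obtain ⟨m, rfl⟩ := mem_sweptRegion.1 hy
    rw [hu.apply_flowMap, hu t ht _ ⟨p, rfl⟩, ← h0]
    exact m.1.2.1
  have hd := (differentiableOn_arrivalTime hF hinj hu).hasFDerivAt hnhds
  exact ne_zero_of_hasFDerivWithinAt_arrivalTime hF hu (interior_subset hx)
    hd.hasFDerivWithinAt hmin.fderiv_eq_zero

/-- By the inverse function theorem u is locally the time component of a smooth right inverse of the
flow in the chart. -/
theorem contDiffAt_arrivalTime (hF : IsClassicalSolution T F) (hu : IsArrivalTime T F u) {t : ℝ}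
    (ht : t ∈ timeInterval T) (h0 : 0 < t) (p : N) : ContDiffAt ℝ ∞ u (F t p) := by
  obtain ⟨A, ν, hA, -⟩ := exists_hasFDerivWithinAt_chartFlow hF ht p
  have hS : timeInterval T ×ˢ (extChartAt (𝓡 n) p).target ∈ 𝓝 (t, extChartAt (𝓡 n) p p) :=
    prod_mem_nhds (timeInterval_mem_nhds ht h0)
      ((isOpen_extChartAt_target p).mem_nhds (mem_extChartAt_target p))
  have hA' := hA.hasFDerivAt hS
  have hc := (contDiffOn_chartFlow hF p).contDiffAt hS
  have hx : chartFlow F p (t, extChartAt (𝓡 n) p p) = F t p := by simp [chartFlow]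
  have hn : (∞ : WithTop ℕ∞) ≠ 0 := by simp
  have hinv := hc.to_localInverse hA' hn
  rw [hx] at hinv
  refine (contDiffAt_fst.comp _ hinv).congr_of_eventuallyEq ?_
  have hst := hc.hasStrictFDerivAt' hA' hn
  have h1 := hst.eventually_right_inverse
  have h2 := hst.localInverse_tendsto.eventually hS
  rw [hx] at h1 h2
  filter_upwards [h1, h2] with y hy1 hy2
  have := hu _ hy2.1 _ ⟨(extChartAt (𝓡 n) p).symm (hst.localInverse _ _ _ y).2, rfl⟩
  change u (chartFlow F p (hst.localInverse _ _ _ y)) = _ at this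
  rw [hy1] at this
  exact this

/-- The unit normal field `∇u / |∇u|` of the level sets of `u`. -/
noncomputable def unitNormalField {k : ℕ} (u : Euc k → ℝ) (x : Euc k) : Euc k :=
  ‖gradient u x‖⁻¹ • gradient u x

theorem contDiffAt_unitNormalField {k : ℕ} {u : Euc k → ℝ} {x : Euc k} (hu : ContDiffAt ℝ ∞ u x)
    (h0 : gradient u x ≠ 0) : ContDiffAt ℝ 1 (unitNormalField u) x := by
  have h1 : ContDiffAt ℝ 1 (gradient u) x :=
    (InnerProductSpace.toDual ℝ (Euc k)).symm.contDiff.contDiffAt.comp x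
      (hu.fderiv_right (m := 1) (WithTop.coe_le_coe.2 le_top))
  exact ((h1.norm ℝ h0).inv (norm_ne_zero_iff.2 h0)).smul h1

theorem norm_unitNormalField {k : ℕ} {u : Euc k → ℝ} {x : Euc k} (h0 : gradient u x ≠ 0) :
    ‖unitNormalField u x‖ = 1 := by
  rw [unitNormalField, norm_smul, norm_inv, norm_norm, inv_mul_cancel₀ (norm_ne_zero_iff.2 h0)]

/-- The divergence of the unit normal field of the flow surfaces is their mean curvature, which is
the norm of the gradient of the arrival time. -/
theorem divergence_unitNormalField (hF : IsClassicalSolution T F) (hu : IsArrivalTime T F u)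
    {Ω : Set (Euc (n + 1))} (hΩ : IsOpen Ω) (hcd : ContDiffOn ℝ ∞ u Ω)
    (hne : ∀ x ∈ Ω, gradient u x ≠ 0) {t : ℝ} (ht : t ∈ timeInterval T) {p : N}
    (hx : F t p ∈ Ω) :
    ∑ i, (fderiv ℝ (unitNormalField u) (F t p) (EuclideanSpace.single i 1)) i =
      ‖gradient u (F t p)‖ := by
  obtain ⟨A, ν, hA, hX, -, hν, hperp, hdet, hH, hA1⟩ := exists_hasFDerivWithinAt_chartFlow hF ht p
  set y₀ := extChartAt (𝓡 n) p p with hy₀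
  set X := localParam (F t) p with hXdef
  set W := unitNormalField u with hWdef
  have hdiff : ∀ x ∈ Ω, DifferentiableAt ℝ u x := fun x hx =>
    (hcd.contDiffAt (hΩ.mem_nhds hx)).differentiableAt (by simp)
  have hgrad := gradient_arrivalTime hu ht (hdiff _ hx) hA hν hperp hH hA1
  have hnorm : ‖gradient u (F t p)‖ = meanCurvature (F t) ν p := by
    rw [hgrad, norm_smul, hν, mul_one, Real.norm_of_nonneg hH.le]
  have hX0 : X y₀ = F t p := by simp [hXdef, localParam, hy₀]
  have hWx : W (F t p) = ν := by
    rw [hWdef, unitNormalField, hnorm, hgrad, smul_smul, inv_mul_cancel₀ hH.ne', one_smul]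
  have hWd : HasFDerivAt W (fderiv ℝ W (F t p)) (F t p) :=
    ((contDiffAt_unitNormalField (hcd.contDiffAt (hΩ.mem_nhds hx)) (hne _ hx)).differentiableAt
      one_ne_zero).hasFDerivAt
  have hXc : ContDiffOn ℝ ∞ X (extChartAt (𝓡 n) p).target :=
    (contDiffOn_chartFlow hF p).comp (f := fun y : Euc n => (t, y)) (by fun_prop)
      fun y hy => ⟨ht, hy⟩
  have htgt : (extChartAt (𝓡 n) p).target ∈ 𝓝 y₀ :=
    (isOpen_extChartAt_target p).mem_nhds (mem_extChartAt_target p)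
  have hXat : ContDiffAt ℝ ∞ X y₀ := hXc.contDiffAt htgt
  have hbA : ∀ i, fderiv ℝ X y₀ (EuclideanSpace.single i 1) = A (0, EuclideanSpace.single i 1) :=
    fun i => by rw [hX.fderiv]; rfl
  -- u is constant along X, so W is normal to the whole surface near p; differentiating this
  -- identity turns -⟨∂ᵢ∂ⱼX, ν⟩ into ⟨∂ⱼX, DW ∂ᵢX⟩.
  have hperpX : ∀ j, ∀ᶠ y in 𝓝 y₀,
      inner ℝ (fderiv ℝ X y (EuclideanSpace.single j 1)) (W (X y)) = 0 := by
    intro j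
    have h1 : ∀ᶠ y in 𝓝 y₀, X y ∈ Ω :=
      hXat.continuousAt.eventually (hX0 ▸ hΩ.mem_nhds hx)
    filter_upwards [h1, eventually_mem_nhds_iff.2 htgt] with y hy hyt
    have h2 := (hdiff _ hy).hasFDerivAt.comp y
      ((hXc.contDiffAt hyt).differentiableAt (by simp)).hasFDerivAt
    have h3 : u ∘ X = fun _ => t := by
      funext z
      exact hu t ht _ ⟨_, rfl⟩
    rw [h3] at h2
    have h4 := congrArg (fun B => B (EuclideanSpace.single j 1)) (h2.unique (hasFDerivAt_const t y))
    simp only [ContinuousLinearMap.comp_apply, _root_.zero_apply] at h4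
    rw [hWdef, unitNormalField, inner_smul_right, real_inner_comm, gradient,
      InnerProductSpace.toDual_symm_apply, h4, mul_zero]
  have hsecond : ∀ i j, secondFundamentalForm (F t) ν p i j =
      inner ℝ (fderiv ℝ X y₀ (EuclideanSpace.single j 1))
        (fderiv ℝ W (F t p) (fderiv ℝ X y₀ (EuclideanSpace.single i 1))) := by
    intro i j
    have hZ : DifferentiableAt ℝ (fun y => fderiv ℝ X y (EuclideanSpace.single j 1)) y₀ :=
      (((hXat.fderiv_right (m := 1) (WithTop.coe_le_coe.2 le_top)).differentiableAt
        one_ne_zero).clm_apply (differentiableAt_const _))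
    have hWX : HasFDerivAt (fun y => W (X y)) ((fderiv ℝ W (F t p)).comp (fderiv ℝ X y₀)) y₀ := by
      rw [← hX0] at hWd
      have := hWd.comp y₀ (hXat.differentiableAt (by simp)).hasFDerivAt
      rwa [hX0] at this
    have h1 := hZ.hasFDerivAt.inner ℝ hWX
    have h2 : (fun y => inner ℝ (fderiv ℝ X y (EuclideanSpace.single j 1)) (W (X y))) =ᶠ[𝓝 y₀]
        fun _ => (0 : ℝ) := hperpX j
    have h3 := (h1.congr_of_eventuallyEq h2.symm).unique (hasFDerivAt_const (0 : ℝ) y₀)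
    have h4 := congrArg (fun B => B (EuclideanSpace.single i 1)) h3
    simp only [ContinuousLinearMap.comp_apply, ContinuousLinearMap.prod_apply, fderivInnerCLM_apply,
      _root_.zero_apply, hX0, hWx] at h4
    simp only [secondFundamentalForm, Matrix.of_apply]
    linarith
  -- Differentiate |W|² = 1: the normal direction contributes nothing to the trace.
  have hDν : inner ℝ (fderiv ℝ W (F t p) ν) ν = 0 := by
    have h1 := hWd.inner ℝ hWd
    have h2 : (fun y => inner ℝ (W y) (W y)) =ᶠ[𝓝 (F t p)] fun _ => (1 : ℝ) := by
      filter_upwards [hΩ.mem_nhds hx] with y hy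
      rw [real_inner_self_eq_norm_sq, hWdef, norm_unitNormalField (hne y hy), one_pow]
    have h3 := (h1.congr_of_eventuallyEq h2.symm).unique (hasFDerivAt_const (1 : ℝ) _)
    have h4 := congrArg (fun B => B ν) h3
    simp only [ContinuousLinearMap.comp_apply, ContinuousLinearMap.prod_apply, fderivInnerCLM_apply,
      _root_.zero_apply, hWx] at h4
    rw [real_inner_comm] at h4
    linarith
  rw [hnorm, meanCurvature]
  refine sum_apply_single_eq_trace (b := fun i => fderiv ℝ X y₀ (EuclideanSpace.single i 1))
    (fun i j => rfl) hdet hν (fun i => by rw [hbA]; exact hperp _) (fun v => ?_) hDν hsecond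
  obtain ⟨⟨s, w⟩, rfl⟩ := A.surjective v
  refine ⟨s * (1 / meanCurvature (F t) ν p), w, ?_⟩
  have hsw : ((s, w) : ℝ × Euc n) = s • (1, 0) + ∑ i, w i • (0, EuclideanSpace.single i 1) := by
    ext k
    · simp [Prod.fst_sum]
    · simp [Prod.snd_sum, Finset.sum_apply, Pi.single_apply]
  rw [hsw, map_add, map_smul, hA1, smul_smul, map_sum]
  simp only [map_smul, hbA]

theorem isVariationalSolution_arrivalTime [CompactSpace N] [ConnectedSpace N]
    (hF : IsClassicalSolution T F) (hinj : Function.Injective (flowMap T F))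
    (hu : IsArrivalTime T F u) : IsVariationalSolution (interior (sweptRegion T F)) u := by
  have hpt : ∀ x ∈ interior (sweptRegion T F), ∃ t ∈ timeInterval T, ∃ p, 0 < t ∧ F t p = x := by
    intro x hx
    obtain ⟨⟨⟨t, ht⟩, p⟩, rfl⟩ := mem_sweptRegion.1 (interior_subset hx)
    exact ⟨t, ht, p, pos_of_mem_interior_sweptRegion hF hinj hu ht hx, rfl⟩
  have hcd : ContDiffOn ℝ ∞ u (interior (sweptRegion T F)) := by
    intro x hx
    obtain ⟨t, ht, p, h0, rfl⟩ := hpt x hx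
    exact (contDiffAt_arrivalTime hF hu ht h0 p).contDiffWithinAt
  have hne : ∀ x ∈ interior (sweptRegion T F), gradient u x ≠ 0 := by
    intro x hx h
    have hd : DifferentiableAt ℝ u x :=
      (hcd.contDiffAt (isOpen_interior.mem_nhds hx)).differentiableAt (by simp)
    refine ne_zero_of_hasFDerivWithinAt_arrivalTime hF hu (interior_subset hx)
      hd.hasFDerivAt.hasFDerivWithinAt ?_
    simpa [gradient] using h
  refine isVariationalSolution_of_calibration isOpen_interior (W := unitNormalField u)
    (hcd.of_le (by exact_mod_cast le_top)) (fun x hx => ?_)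
    (fun x hx => (norm_unitNormalField (hne x hx)).le) (fun x hx => ?_) fun x hx => ?_
  · exact (contDiffAt_unitNormalField (hcd.contDiffAt (isOpen_interior.mem_nhds hx))
      (hne x hx)).contDiffWithinAt
  · rw [unitNormalField, inner_smul_right, real_inner_self_eq_norm_sq, sq, ← mul_assoc,
      inv_mul_cancel₀ (norm_ne_zero_iff.2 (hne x hx)), one_mul]
  · obtain ⟨t, ht, p, -, rfl⟩ := hpt x hx
    exact divergence_unitNormalField hF hu isOpen_interior hcd hne ht hx

end

end IMCF

theorem theorem4 {n : ℕ} {N : Type*} [TopologicalSpace N] [ChartedSpace (Euc n) N]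
    [IsManifold (𝓡 n) ∞ N] [T2Space N] [CompactSpace N] [ConnectedSpace N]
    (T : EReal) (hT : 0 < T) (F : ℝ → N → Euc (n + 1)) (hF : IsClassicalSolution T F)
    (hF₀ : ∃ p : N, ∀ q : N, F 0 q = F 0 p → q = p) :
    ((∃ u : Euc (n + 1) → ℝ, IsArrivalTime T F u ∧
        DifferentiableOn ℝ u (sweptRegion T F) ∧
        ∀ x ∈ sweptRegion T F, gradientWithin u (sweptRegion T F) x ≠ 0) ↔
      ∀ t ∈ timeInterval T, Manifold.IsSmoothEmbedding (𝓡 n) 𝓘(ℝ, Euc (n + 1)) ∞ (F t)) ∧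
    ((∀ t ∈ timeInterval T, Manifold.IsSmoothEmbedding (𝓡 n) 𝓘(ℝ, Euc (n + 1)) ∞ (F t)) →
      ∀ u : Euc (n + 1) → ℝ, IsArrivalTime T F u →
        IsVariationalSolution (interior (sweptRegion T F)) u) :=
  ⟨arrivalTime_iff_isSmoothEmbedding hT hF hF₀, fun h _ hu =>
    isVariationalSolution_arrivalTime hF
      (injective_flowMap hF fun t ht => (h t ht).isEmbedding.injective) hu⟩
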